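/- \textbf{Setting.} For a subset $E$ of the standard basis $U=\{u_1,\dots,u_M\}$ of $\mathbb R^M$ let $\mathcal O(E)=\{\sum_{u\in E}\lambda_u u:\lambda_u>0\}$ be the open positive orthant with axes $E$, let $\mathbb R(E)$ be the span of $E$, and let $P_E$ be the orthogonal projection of $\mathbb R^M$ onto $\mathbb R(E)$. An orthant space $X$ of dimension $m$ is a union of such orthants (its strata), of maximum dimension $m$, such that with every stratum all the orthants in its closure are strata, and such that every positive orthant of dimension at least two, all of whose two-dimensional faces are strata, is a stratum. The distance $d(x,y)$ on $X$ is the infimum of the lengths of the piecewise linear paths in $X$ from $x$ to $y$; with it $X$ is a CAT(0) space, so any two points are joined by a unique geodesic. The co-dimension of $\mathcal O(E)$ is $m-|E|$. A stratum $\tau=\mathcal O(T)$ co-bounds $\sigma=\mathcal O(E)$ if $E\subseteq T$; then $\mathcal S_{\tau\setminus\sigma}$ denotes the set of unit vectors in $\mathcal O(T\setminus E)$. For $x',x\in X$ let $\log_{x'}(x)\in\mathbb R^M$ be the initial tangent vector, of norm $d(x',x)$, of the geodesic from $x'$ to $x$, and let $\Phi(x;x')=\log_{x'}(x)+x'$.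 For $x^*\in\sigma=\mathcal O(E)$ let $\Phi_\sigma(x;x^*)=P_E(\Phi(x;x^*))$, and, for $\tau=\mathcal O(T)$ co-bounding $\sigma$ and $w_\tau\in\mathcal S_{\tau\setminus\sigma}$, let $\Psi(x,w_\tau;x^*)=\lim_{\lambda\to0+}\Phi(x;x^*+\lambda w_\tau)$ and $\Psi_\tau(x,w_\tau;x^*)=P_T(\Psi(x,w_\tau;x^*))$. Let $\mu$ be a Borel probability measure on $X$ whose Fréchet function $F(y)=\frac12\int_X d(y,x)^2\,d\mu(x)$ is finite for at least one $y\in X$. A point of $X$ at which $F$ attains its global minimum is called a Fréchet mean of $\mu$. \textbf{Theorem.} Let $\sigma$ be a stratum of $X$ of co-dimension $l\ge 0$ and let $x^*\in\sigma$. Then the integrals in (i) and (ii) below exist, and $x^*$ is the Fréchet mean of $\mu$ if and only if both of the following conditions hold: (i) for every stratum $\tau$ of $X$ that co-bounds $\sigma$ and has co-dimension $l'$ with $0\le l'<l$, and for every $w_\tau\in\mathcal S_{\tau\setminus\sigma}$, $$\Big\langle w_\tau,\int_X\Psi_\tau(x,w_\tau;x^*)\,d\mu(x)\Big\rangle\le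 0;$$ (ii) $$x^*=\int_X\Phi_\sigma(x;x^*)\,d\mu(x).$$ Moreover, if $x^*$ is a Fréchet mean of $\mu$, then it is the only one: $F(x^*)<F(z)$ for every $z\in X$ with $z\ne x^*$. -/

import Mathlib

open MeasureTheory Filter Topology Set
open scoped ENNReal

noncomputable section

/-- The open positive orthant of `ℝ^M` spanned by the standard basis vectors with index in `E`. -/
def orthant {M : ℕ} (E : Finset (Fin M)) : Set (EuclideanSpace ℝ (Fin M)) :=
  {x | (∀ i ∈ E, 0 < x i) ∧ ∀ i ∉ E, x i = 0}

/-- An orthant space of dimension `m` in `ℝ^M`, given by the sets of axes of its orthants (strata).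
The orthants in the closure of `orthant E` are the `orthant D` with `D ⊆ E`. The flag condition
is only imposed on orthants of dimension at least two (for smaller ones it would be an empty
premise), so that axes of `ℝ^M` which do not occur in the space are allowed. -/
structure OrthantSpace (M m : ℕ) where
  /-- the sets of axes of the strata -/
  faces : Set (Finset (Fin M))
  /-- the strata in the closure of a stratum are strata -/
  down_closed : ∀ E ∈ faces, ∀ D ⊆ E, D ∈ faces
  /-- an orthant all of whose two-dimensional faces are strata is a stratum -/
  flag : ∀ E : Finset (Fin M), 2 ≤ E.card →
    (∀ D ⊆ E, D.card = 2 → D ∈ faces) → E ∈ faces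
  /-- the maximum dimension of the strata is `m` -/
  dim_eq : IsGreatest (Finset.card '' faces) m

namespace OrthantSpace

variable {M m : ℕ} (X : OrthantSpace M m)

/-- The underlying set of the orthant space: the union of its orthants. -/
def carrier : Set (EuclideanSpace ℝ (Fin M)) :=
  ⋃ E ∈ X.faces, orthant E

/-- The co-dimension of the stratum `orthant E` of `X`. -/
def codim (_X : OrthantSpace M m) (E : Finset (Fin M)) : ℕ := m - E.card

/-- `L` is the length of a piecewise linear path from `x` to `y` in `X`, with `n` linear pieces
and vertices `p 0, …, p n`. -/
def IsPathLength (x y : EuclideanSpace ℝ (Fin M)) (L : ℝ) : Prop :=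
  ∃ (n : ℕ) (p : ℕ → EuclideanSpace ℝ (Fin M)), p 0 = x ∧ p n = y ∧
    (∀ i < n, segment ℝ (p i) (p (i + 1)) ⊆ X.carrier) ∧
    L = ∑ i ∈ Finset.range n, dist (p i) (p (i + 1))

/-- The intrinsic metric of `X`: the infimum of the lengths of the piecewise linear paths in `X`
that join the two points (for two points of `X` there is always one, through the origin). -/
def idist (x y : EuclideanSpace ℝ (Fin M)) : ℝ :=
  sInf {L | X.IsPathLength x y L}

/-- `γ`, restricted to `[0, 1]`, is a geodesic of `X` from `x` to `y`, parametrised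
proportionally to arc length. -/
def IsGeodesic (x y : EuclideanSpace ℝ (Fin M)) (γ : ℝ → EuclideanSpace ℝ (Fin M)) : Prop :=
  γ 0 = x ∧ γ 1 = y ∧ (∀ t ∈ Icc (0 : ℝ) 1, γ t ∈ X.carrier) ∧
    ∀ s ∈ Icc (0 : ℝ) 1, ∀ t ∈ Icc (0 : ℝ) 1, X.idist (γ s) (γ t) = |s - t| * X.idist x y

/-- `v` is the initial tangent vector at `x` of a geodesic from `x` to `y` run through in unit
time (so that the norm of `v` is the intrinsic distance of `x` and `y`). -/
def IsInitialTangent (x y v : EuclideanSpace ℝ (Fin M)) : Prop :=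
  ∃ γ : ℝ → EuclideanSpace ℝ (Fin M), X.IsGeodesic x y γ ∧ HasDerivWithinAt γ v (Ici 0) 0

/-- The logarithm map: `X.logMap xs x` is the initial tangent vector at `xs` of the geodesic from
`xs` to `x`, as a vector of `ℝ^M`; the stratum `ℝ(E) × O(F)` of the tangent cone at a point of
`orthant E` is the corresponding subset of `ℝ^M`. -/
def logMap (xs x : EuclideanSpace ℝ (Fin M)) : EuclideanSpace ℝ (Fin M) :=
  Classical.epsilon fun v => X.IsInitialTangent xs x v

/-- The translated logarithm map `Φ(x; xs) = log_{xs}(x) + xs`. -/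
def Phi (x xs : EuclideanSpace ℝ (Fin M)) : EuclideanSpace ℝ (Fin M) :=
  X.logMap xs x + xs

/-- The directional limit `Ψ(x, w; xs)` of `Φ(x; xs')`, as `xs'` tends to `xs` along the geodesic
that starts at `xs` with initial tangent vector `w`. For `xs` in a stratum `orthant E` and `w`
tangent to a co-bounding stratum, this geodesic is the straight line `lam ↦ xs + lam • w`. -/
def Psi (x w xs : EuclideanSpace ℝ (Fin M)) : EuclideanSpace ℝ (Fin M) :=
  limUnder (𝓝[>] (0 : ℝ)) fun lam => X.Phi x (xs + lam • w)

/-- The orthogonal projection of `ℝ^M` onto the subspace `ℝ(E)` spanned by the axes in `E`. -/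
def proj (E : Finset (Fin M)) (v : EuclideanSpace ℝ (Fin M)) : EuclideanSpace ℝ (Fin M) :=
  WithLp.toLp 2 fun i => if i ∈ E then v i else 0

/-- `Φ_σ = P_σ ∘ Φ` for the stratum `σ = orthant E`. -/
def PhiProj (E : Finset (Fin M)) (x xs : EuclideanSpace ℝ (Fin M)) :
    EuclideanSpace ℝ (Fin M) :=
  proj E (X.Phi x xs)

/-- `Ψ_τ = P_τ ∘ Ψ` for the stratum `τ = orthant T`. -/
def PsiProj (T : Finset (Fin M)) (x w xs : EuclideanSpace ℝ (Fin M)) :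
    EuclideanSpace ℝ (Fin M) :=
  proj T (X.Psi x w xs)

/-- The set `S_{τ∖σ}` of the unit vectors tangent to `τ = orthant T` and orthogonal to
`σ = orthant E`, where `E ⊆ T`: the unit vectors in `{0} × O(T ∖ E)`. -/
def unitNormals (T E : Finset (Fin M)) : Set (EuclideanSpace ℝ (Fin M)) :=
  {w | w ∈ orthant (T \ E) ∧ ‖w‖ = 1}

/-- The Fréchet function of a measure on `X`. -/
def frechetFunction (μ : Measure X.carrier) (y : EuclideanSpace ℝ (Fin M)) : ℝ≥0∞ :=
  (1 / 2) * ∫⁻ x : X.carrier, ENNReal.ofReal (X.idist y x ^ 2) ∂μ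

/-- `y` is a Fréchet mean of `μ`: a point of `X` where the Fréchet function attains its global
minimum. -/
def IsFrechetMean (μ : Measure X.carrier) (y : EuclideanSpace ℝ (Fin M)) : Prop :=
  y ∈ X.carrier ∧ ∀ z ∈ X.carrier, X.frechetFunction μ y ≤ X.frechetFunction μ z

end OrthantSpace

end

/-! ### The comparison inequality in metric spaces -/

/-! In a `CAT(0)` space each function `y ↦ d(y, x)²` is strongly convex along geodesics, hence so is
the Fréchet function. A minimum is therefore unique, and it is detected by first order conditions at
`x*`. Along `σ` these say that the mean of the logarithms has no component in `ℝ(E)`, which is (ii).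
In a normal direction `w` only a one-sided condition remains, that the mean limiting logarithm has
non-positive inner product with `w`, which is (i).

The `CAT(0)` inequality is proved rather than assumed. Vertices are added one at a time
(`isCAT0_sub`): a new vertex `v` glues its star, a product of a smaller subcomplex with a half-line
(`isCAT0_star`), onto the complex built so far, along a subcomplex that is convex because coordinate
projections do not increase lengths. The flag condition makes the star a full product. The gluing
theorem `Glueable.isCAT0_union` reduces to a first order comparison (`Hinge`), obtained from two
Euclidean triangles on opposite sides of a common side (`planar_hinge`).

Close to `x` every point has a support containing that of `x`, so short geodesics from `x` are
straight segments. Comparing with such a segment bounds `d(z, y)²`, for `z` in the closed stratum of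
`x`, from below without error term (`IPoint.le_dist_sq`) and from above up to a quadratic one
(`IPoint.dist_sq_le`). The limits that define `Ψ` exist because dilations about `x` scale the metric
nearby: this bounds the change of the logarithm between two points of one ray by a multiple of the
distance to `x` (`IsRadius.norm_log_sub_log_le`). The lower bound survives the limit
(`IsRay.le_dist_sq`), and the limit has the same components along `σ` as the logarithm at `x`
(`IsRay.inner_eq`).

Integrating these bounds gives both directions. At a minimum, (ii) follows from the upper bound at
`x*`, and (i) from the lower bound applied at the points of a ray and then passed to the limit.
Conversely, the lower bound and the two conditions show that `x*` does at least as well as its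
neighbours on any geodesic from it, and strong convexity makes this global and strict
(`energy_lt_of_conditions`). -/

section Comparison

variable {α : Type*} [MetricSpace α]

/-- `m` lies on a geodesic from `p` to `q`, at the parameter `t`. -/
def IsPt (p q : α) (t : ℝ) (m : α) : Prop :=
  dist p m = t * dist p q ∧ dist m q = (1 - t) * dist p q

/-- The comparison inequality for `m` at parameter `t` between `p` and `q`, seen from `z`. -/
def CNAt (p q : α) (t : ℝ) (m z : α) : Prop :=
  dist z m ^ 2 ≤ (1 - t) * dist z p ^ 2 + t * dist z q ^ 2 - t * (1 - t) * dist p q ^ 2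

/-- A subset of a metric space that is geodesic and satisfies the `CAT(0)` inequality. -/
structure IsCAT0 (S : Set α) : Prop where
  exists_isPt : ∀ p ∈ S, ∀ q ∈ S, ∀ t ∈ Icc (0 : ℝ) 1, ∃ m ∈ S, IsPt p q t m
  cnAt : ∀ p ∈ S, ∀ q ∈ S, ∀ m ∈ S, ∀ z ∈ S, ∀ t ∈ Icc (0 : ℝ) 1, IsPt p q t m → CNAt p q t m z

theorem IsPt.symm {p q m : α} {t : ℝ} (h : IsPt p q t m) : IsPt q p (1 - t) m := by
  unfold IsPt at *
  rw [dist_comm q m, dist_comm q p, dist_comm m p]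
  exact ⟨h.2, by rw [h.1]; ring⟩

theorem IsPt.of_le {p q m : α} {t : ℝ} (h1 : dist p m ≤ t * dist p q)
    (h2 : dist m q ≤ (1 - t) * dist p q) : IsPt p q t m := by
  have := dist_triangle p m q
  constructor <;> linarith

theorem IsPt.cnAt_eq {p q m m' : α} {t : ℝ} (hm : IsPt p q t m') (h : CNAt p q t m m') :
    m' = m := by
  have h1 : dist m' p = t * dist p q := by rw [dist_comm]; exact hm.1
  unfold CNAt at h
  rw [h1, hm.2] at h
  have : dist m' m ^ 2 ≤ 0 := by nlinarith
  have : dist m' m = 0 := by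
    have := sq_nonneg (dist m' m)
    exact pow_eq_zero_iff (two_ne_zero) |>.1 (by linarith)
  exact dist_eq_zero.1 this

theorem IsPt.of_cnAt {p q m : α} {t : ℝ} (ht : t ∈ Icc (0 : ℝ) 1) (hp : CNAt p q t m p)
    (hq : CNAt p q t m q) : IsPt p q t m := by
  have ht1 : 0 ≤ 1 - t := by linarith [ht.2]
  unfold CNAt at hp hq
  rw [dist_self] at hp hq
  rw [dist_comm q p, dist_comm q m] at hq
  refine IsPt.of_le ?_ ?_
  · refine abs_le_of_sq_le_sq' ?_ (mul_nonneg ht.1 dist_nonneg) |>.2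
    nlinarith
  · refine abs_le_of_sq_le_sq' ?_ (mul_nonneg ht1 dist_nonneg) |>.2
    nlinarith

/-- One good point per parameter suffices. The inequality seen from `p` and `q` places it on a
geodesic, and seen from any rival at the same parameter it forces the distance between the two to
vanish. -/
theorem IsCAT0.of_exists {S : Set α}
    (h : ∀ p ∈ S, ∀ q ∈ S, ∀ t ∈ Icc (0 : ℝ) 1, ∃ m ∈ S, ∀ z ∈ S, CNAt p q t m z) :
    IsCAT0 S where
  exists_isPt p hp q hq t ht := by
    obtain ⟨m, hm, hz⟩ := h p hp q hq t ht
    exact ⟨m, hm, IsPt.of_cnAt ht (hz p hp) (hz q hq)⟩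
  cnAt p hp q hq m hm z hz t ht hpt := by
    obtain ⟨m', hm', hz'⟩ := h p hp q hq t ht
    rw [hpt.cnAt_eq (hz' m hm)]
    exact hz' z hz

/-- First order form, at `c`, of the comparison inequality for the geodesics in `S` from `c`
to `x`, seen from `y`. -/
def Hinge (S : Set α) (c x y : α) : Prop :=
  ∃ K, ∃ ε₀ > (0 : ℝ), ∀ ε ∈ Ioo 0 ε₀, ∀ w ∈ S, IsPt c x ε w →
    dist y w ^ 2 ≤ dist c y ^ 2 + ε * (dist x y ^ 2 - dist c y ^ 2 - dist c x ^ 2) + K * ε ^ 2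

theorem IsCAT0.hinge {S : Set α} (h : IsCAT0 S) {c x y : α} (hc : c ∈ S) (hx : x ∈ S)
    (hy : y ∈ S) : Hinge S c x y := by
  refine ⟨dist c x ^ 2, 1, one_pos, fun ε hε w hw hpt => ?_⟩
  have := h.cnAt c hc x hx w hw y hy ε ⟨hε.1.le, hε.2.le⟩ hpt
  unfold CNAt at this
  rw [dist_comm c y, dist_comm x y]
  nlinarith

theorem nonneg_of_forall_small {a K ε₀ : ℝ} (h0 : 0 < ε₀)
    (h : ∀ ε ∈ Ioo 0 ε₀, 0 ≤ a + K * ε) : 0 ≤ a := by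
  have ht : Tendsto (fun ε : ℝ => a + K * ε) (𝓝[>] 0) (𝓝 a) := by
    have : ContinuousAt (fun ε : ℝ => a + K * ε) 0 := by fun_prop
    have := this.tendsto
    simp only [mul_zero, add_zero] at this
    exact this.mono_left nhdsWithin_le_nhds
  exact ge_of_tendsto ht (Filter.mem_of_superset (Ioo_mem_nhdsGT h0) h)

/-- Moving from `c` a little towards `z` cannot decrease the sum of the distances to `p` and `q`,
which is already minimal at `c`. The two hinges bound the first order change of these distances from
above; weighting them, dividing by `ε` and letting `ε` tend to `0` leaves the claim. -/
theorem cn_of_hinge {S : Set α} {p q c z : α} (hpq : dist p q = dist p c + dist c q)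
    (hA : 0 < dist p c) (hB : 0 < dist c q) (hp : Hinge S c z p) (hq : Hinge S c z q)
    (hex : ∀ ε ∈ Ioo (0 : ℝ) 1, ∃ w ∈ S, IsPt c z ε w) :
    (dist p c + dist c q) * dist z c ^ 2 ≤ dist c q * dist z p ^ 2 + dist p c * dist z q ^ 2
      - dist p c * dist c q * (dist p c + dist c q) := by
  obtain ⟨K, ε₁, h1, hp⟩ := hp
  obtain ⟨L, ε₂, h2, hq⟩ := hq
  set A := dist p c
  set B := dist c q
  rw [dist_comm c z] at *
  suffices 0 ≤ B * (dist z p ^ 2 - A ^ 2 - dist z c ^ 2) + A * (dist z q ^ 2 - B ^ 2 - dist z c ^ 2)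
    by linarith
  refine nonneg_of_forall_small (K := B * K + A * L) (lt_min one_pos (lt_min h1 h2)) ?_
  intro ε hε
  obtain ⟨hε0, hε'⟩ := hε
  rw [lt_min_iff, lt_min_iff] at hε'
  obtain ⟨w, hw, hpt⟩ := hex ε ⟨hε0, hε'.1⟩
  have ha := hp ε ⟨hε0, hε'.2.1⟩ w hw hpt
  have hb := hq ε ⟨hε0, hε'.2.2⟩ w hw hpt
  have hA' : dist c p = A := dist_comm _ _
  rw [hA'] at ha
  have htri : A + B ≤ dist p w + dist q w := by
    rw [← hpq, dist_comm q w]; exact dist_triangle _ _ _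
  have ea : 2 * A * (dist p w - A) ≤ dist p w ^ 2 - A ^ 2 := by nlinarith [sq_nonneg (dist p w - A)]
  have eb : 2 * B * (dist q w - B) ≤ dist q w ^ 2 - B ^ 2 := by nlinarith [sq_nonneg (dist q w - B)]
  have e1 : 2 * A * (dist p w - A) * B ≤
      (ε * (dist z p ^ 2 - A ^ 2 - dist z c ^ 2) + K * ε ^ 2) * B :=
    mul_le_mul_of_nonneg_right (by linarith) hB.le
  have e2 : 2 * B * (dist q w - B) * A ≤
      (ε * (dist z q ^ 2 - B ^ 2 - dist z c ^ 2) + L * ε ^ 2) * A :=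
    mul_le_mul_of_nonneg_right (by linarith) hA.le
  have e3 : 0 ≤ 2 * A * B * (dist p w + dist q w - A - B) :=
    mul_nonneg (by positivity) (by linarith)
  have e4 : 0 ≤ ε * (B * (dist z p ^ 2 - A ^ 2 - dist z c ^ 2) +
      A * (dist z q ^ 2 - B ^ 2 - dist z c ^ 2) + (B * K + A * L) * ε) := by linarith
  exact nonneg_of_mul_nonneg_right e4 hε0

end Comparison

/-! ### Gluing along a convex subset -/

theorem le_mul_of_sq_add_sq {a b c d r q : ℝ} (hr : 0 ≤ r) (hq : 0 ≤ q)
    (h1 : r ^ 2 = a ^ 2 + b ^ 2) (h2 : q ^ 2 = c ^ 2 + d ^ 2) : a * c + b * d ≤ r * q := by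
  refine (abs_le_of_sq_le_sq' ?_ (mul_nonneg hr hq)).2
  rw [mul_pow, h1, h2]
  nlinarith [sq_nonneg (a * d - b * c)]

/-- The case in which the path from `z` is best led through the common vertex `0`, that is, `s = 0`.
-/
theorem planar_hinge_of_add_le {ζ ρ β r q : ℝ} (hζ : 0 ≤ ζ) (hρ : 0 ≤ ρ)
    (hD : ζ + ρ ≤ r + q) :
    ∃ K, ∃ ε₀ > (0 : ℝ), ∀ ε ∈ Ioo 0 ε₀, ∃ s ∈ Icc (0 : ℝ) 1, ∃ u v : ℝ, 0 ≤ u ∧ 0 ≤ v ∧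
      (1 - s) * ζ ^ 2 + s * r ^ 2 - s * (1 - s) * β ^ 2 ≤ u ^ 2 ∧
      (1 - s) * (ε * ρ) ^ 2 + s * ((1 - ε) * β ^ 2 + ε * q ^ 2 - ε * (1 - ε) * ρ ^ 2)
        - s * (1 - s) * β ^ 2 ≤ v ^ 2 ∧
      (u + v) ^ 2 ≤ ζ ^ 2 + ε * ((r + q) ^ 2 - ζ ^ 2 - ρ ^ 2) + K * ε ^ 2 := by
  refine ⟨ρ ^ 2, 1, one_pos, fun ε hε => ⟨0, by simp, ζ, ε * ρ, hζ, mul_nonneg hε.1.le hρ,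
    by simp, by simp, ?_⟩⟩
  have : (ζ + ρ) ^ 2 ≤ (r + q) ^ 2 := pow_le_pow_left₀ (by positivity) hD 2
  nlinarith [hε.1, mul_le_mul_of_nonneg_left this hε.1.le]

/-- By `hκ` the angles of the two triangles at `0` add up to more than `π`, so the sum of their
cosines `z1 / ζ` and `p1 / ρ` is not positive. Projecting each far side to the direction of `z` or
`p` gives `r ≥ ζ - β * z1 / ζ` and `q ≥ ρ - β * p1 / ρ`. -/
theorem add_le_of_planar {z1 z2 p1 p2 ζ ρ β r q : ℝ} (hβ : 0 < β) (hz2 : 0 < z2) (hp2 : 0 ≤ p2)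
    (hζ : 0 ≤ ζ) (hρ : 0 ≤ ρ) (hr : 0 ≤ r) (hq : 0 ≤ q) (h1 : ζ ^ 2 = z1 ^ 2 + z2 ^ 2)
    (h2 : r ^ 2 = (z1 - β) ^ 2 + z2 ^ 2) (h3 : ρ ^ 2 = p1 ^ 2 + p2 ^ 2)
    (h4 : q ^ 2 = (p1 - β) ^ 2 + p2 ^ 2) (hκ : z1 * p2 + p1 * z2 < 0) : ζ + ρ ≤ r + q := by
  have hζ0 : 0 < ζ := by
    rcases hζ.lt_or_eq with h | h
    · exact h
    · subst h; nlinarith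
  rcases hρ.lt_or_eq with hρ0 | h
  swap
  · subst h
    have hp : p1 = 0 ∧ p2 = 0 := by constructor <;> nlinarith
    rw [hp.1, hp.2] at hκ
    simp at hκ
  have er : ζ - β * z1 / ζ ≤ r := by
    have := le_mul_of_sq_add_sq hζ hr h1 h2
    rw [sub_le_iff_le_add, ← sub_le_iff_le_add', le_div_iff₀ hζ0]
    nlinarith
  have eq : ρ - β * p1 / ρ ≤ q := by
    have := le_mul_of_sq_add_sq hρ hq h3 h4
    rw [sub_le_iff_le_add, ← sub_le_iff_le_add', le_div_iff₀ hρ0]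
    nlinarith
  suffices z1 * ρ + p1 * ζ ≤ 0 by
    have h5 : z1 / ζ + p1 / ρ ≤ 0 := by
      rw [div_add_div _ _ hζ0.ne' hρ0.ne']
      exact div_nonpos_of_nonpos_of_nonneg (by linarith) (by positivity)
    have : β * z1 / ζ + β * p1 / ρ = β * (z1 / ζ + p1 / ρ) := by ring
    nlinarith
  rcases le_or_gt p1 0 with hp1 | hp1
  · rcases le_or_gt z1 0 with hz1 | hz1
    · nlinarith
    · have : z1 * ρ ≤ -p1 * ζ := by
        refine (abs_le_of_sq_le_sq' ?_ (mul_nonneg (by linarith) hζ)).2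
        have : (z1 * p2) ^ 2 ≤ (-p1 * z2) ^ 2 :=
          pow_le_pow_left₀ (by positivity) (by linarith) 2
        rw [mul_pow, mul_pow, h1, h3]
        nlinarith
      linarith
  · have hz1 : z1 < 0 := by
      by_contra! h
      nlinarith [mul_nonneg h hp2, mul_pos hp1 hz2]
    have : p1 * ζ ≤ -z1 * ρ := by
      refine (abs_le_of_sq_le_sq' ?_ (mul_nonneg (by linarith) hρ)).2
      have : (p1 * z2) ^ 2 ≤ (-z1 * p2) ^ 2 :=
        pow_le_pow_left₀ (by positivity) (by linarith) 2
      rw [mul_pow, mul_pow, h1, h3]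
      nlinarith
    linarith

/-- Two Euclidean triangles with the common side from `0` to `b = (β, 0)`: the distance from
`z` to the points near `0` of the side from `0` to `p`, measured across the common side. -/
theorem planar_hinge {z1 z2 p1 p2 ζ ρ β r q : ℝ} (hβ : 0 < β) (hz2 : 0 ≤ z2) (hp2 : 0 ≤ p2)
    (hζ : 0 ≤ ζ) (hρ : 0 ≤ ρ) (hr : 0 ≤ r) (hq : 0 ≤ q) (h1 : ζ ^ 2 = z1 ^ 2 + z2 ^ 2)
    (h2 : r ^ 2 = (z1 - β) ^ 2 + z2 ^ 2) (h3 : ρ ^ 2 = p1 ^ 2 + p2 ^ 2)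
    (h4 : q ^ 2 = (p1 - β) ^ 2 + p2 ^ 2) :
    ∃ K, ∃ ε₀ > (0 : ℝ), ∀ ε ∈ Ioo 0 ε₀, ∃ s ∈ Icc (0 : ℝ) 1, ∃ u v : ℝ, 0 ≤ u ∧ 0 ≤ v ∧
      (1 - s) * ζ ^ 2 + s * r ^ 2 - s * (1 - s) * β ^ 2 ≤ u ^ 2 ∧
      (1 - s) * (ε * ρ) ^ 2 + s * ((1 - ε) * β ^ 2 + ε * q ^ 2 - ε * (1 - ε) * ρ ^ 2)
        - s * (1 - s) * β ^ 2 ≤ v ^ 2 ∧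
      (u + v) ^ 2 ≤ ζ ^ 2 + ε * ((r + q) ^ 2 - ζ ^ 2 - ρ ^ 2) + K * ε ^ 2 := by
  -- With `p` reflected to the other side of the axis, this is the triangle inequality for the path
  -- from `z` to `p` through `b`.
  have hrq : (z1 - p1) ^ 2 + (z2 + p2) ^ 2 ≤ (r + q) ^ 2 := by
    have := le_mul_of_sq_add_sq hr hq (a := z1 - β) (b := z2) (c := β - p1) (d := p2) h2
      (by rw [h4]; ring)
    nlinarith
  have eu : ∀ s, (1 - s) * ζ ^ 2 + s * r ^ 2 - s * (1 - s) * β ^ 2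
      = (z1 - s * β) ^ 2 + z2 ^ 2 := fun s => by rw [h1, h2]; ring
  have ev : ∀ s ε, (1 - s) * (ε * ρ) ^ 2 + s * ((1 - ε) * β ^ 2 + ε * q ^ 2 - ε * (1 - ε) * ρ ^ 2)
        - s * (1 - s) * β ^ 2 = (ε * p1 - s * β) ^ 2 + (ε * p2) ^ 2 := fun s ε => by
    rw [mul_pow, h3, h4]; ring
  rcases hz2.lt_or_eq with hz | hz
  · rcases lt_or_ge (z1 * p2 + p1 * z2) 0 with hκ | hκ
    · exact planar_hinge_of_add_le hζ hρ (add_le_of_planar hβ hz hp2 hζ hρ hr hq h1 h2 h3 h4 hκ)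
    have hζ0 : 0 < ζ := by
      rcases hζ.lt_or_eq with h | h
      · exact h
      · subst h; nlinarith
    -- The line through the reflected `ε p` in the direction of `z` meets the axis at `κ ε`. To
    -- first order this is where the segment from `z` crosses. The number `g` is the first order
    -- coefficient of the resulting length.
    obtain ⟨κ, hκ'⟩ : ∃ κ, κ = (z1 * p2 + p1 * z2) / z2 := ⟨_, rfl⟩
    have hκ0 : 0 ≤ κ := hκ' ▸ div_nonneg hκ hz2
    obtain ⟨g, hg⟩ : ∃ g, g = (p2 * z2 - p1 * z1) / ζ := ⟨_, rfl⟩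
    have hgζ : g * ζ = p2 * z2 - p1 * z1 := by rw [hg]; field_simp
    obtain ⟨H, hH⟩ : ∃ H, H = |g| + κ ^ 2 / (2 * ζ) := ⟨_, rfl⟩
    refine ⟨κ ^ 2 + H ^ 2, min 1 (β / (κ + 1)), by positivity, ?_⟩
    rintro ε ⟨hε0, hε⟩
    rw [lt_min_iff, lt_div_iff₀ (by positivity)] at hε
    -- The value of `u` bounds the distance from `z` to the crossing point by the
    -- arithmetic-geometric mean inequality, which avoids expanding a root; `v` is the exact length
    -- on the other side, by similar triangles.
    refine ⟨κ * ε / β, ⟨by positivity, ?_⟩, (ζ ^ 2 + ((z1 - κ * ε) ^ 2 + z2 ^ 2)) / (2 * ζ),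
      ε * (p2 * ζ / z2), by positivity, by positivity, ?_, ?_, ?_⟩
    · rw [div_le_one hβ]; nlinarith
    · rw [eu, div_mul_cancel₀ _ hβ.ne', div_pow, le_div_iff₀ (by positivity)]
      nlinarith [sq_nonneg (ζ ^ 2 - ((z1 - κ * ε) ^ 2 + z2 ^ 2))]
    · rw [ev, div_mul_cancel₀ _ hβ.ne']
      have : p1 - κ = - (z1 * p2 / z2) := by rw [hκ']; field_simp; ring
      have h5 : (ε * p1 - κ * ε) ^ 2 + (ε * p2) ^ 2 = ε ^ 2 * ((p1 - κ) ^ 2 + p2 ^ 2) := by ring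
      rw [h5, this, mul_pow, div_pow, mul_pow, h1]
      apply le_of_eq
      field_simp
    · have h5 : (ζ ^ 2 + ((z1 - κ * ε) ^ 2 + z2 ^ 2)) / (2 * ζ) + ε * (p2 * ζ / z2)
          = ζ + ε * (g + κ ^ 2 / (2 * ζ) * ε) := by
        have : z1 ^ 2 + z2 ^ 2 = ζ ^ 2 := h1.symm
        have e1 : (ζ ^ 2 + ((z1 - κ * ε) ^ 2 + z2 ^ 2)) / (2 * ζ)
            = ζ - κ * ε * z1 / ζ + κ ^ 2 / (2 * ζ) * ε * ε := by
          have : (z1 - κ * ε) ^ 2 + z2 ^ 2 = ζ ^ 2 - 2 * κ * ε * z1 + κ ^ 2 * ε ^ 2 := by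
            rw [h1]; ring
          rw [this]; field_simp; ring
        have e2 : p2 * ζ / z2 = g + κ * z1 / ζ := by
          rw [hg, hκ']
          field_simp
          rw [h1]; ring
        rw [e1, e2]; ring
      rw [h5]
      set h := g + κ ^ 2 / (2 * ζ) * ε with hh
      have hle : |h| ≤ H := by
        rw [hH]
        refine (abs_add_le _ _).trans (add_le_add le_rfl ?_)
        rw [abs_of_nonneg (by positivity)]
        exact mul_le_of_le_one_right (by positivity) hε.1.le
      have hsq : h ^ 2 ≤ H ^ 2 := by
        rw [← sq_abs h]; exact pow_le_pow_left₀ (abs_nonneg _) hle 2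
      have e3 : (ζ + ε * h) ^ 2 = ζ ^ 2 + ε * (2 * (g * ζ)) + ε ^ 2 * κ ^ 2 + ε ^ 2 * h ^ 2 := by
        rw [hh]; field_simp; ring
      rw [e3, hgζ]
      have e4 := mul_le_mul_of_nonneg_left hsq (sq_nonneg ε)
      have e6 : 2 * (p2 * z2 - p1 * z1) ≤ (r + q) ^ 2 - ζ ^ 2 - ρ ^ 2 := by
        rw [h1, h3]; linarith
      have e5 := mul_le_mul_of_nonneg_left e6 hε0.le
      linarith
  · subst hz
    have hz1 : z1 = ζ ∨ z1 = -ζ := by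
      have : z1 ^ 2 = ζ ^ 2 := by linarith
      exact sq_eq_sq_iff_eq_or_eq_neg.1 this
    -- Now `z` is on the axis: on the common side the path crosses at `z` itself, beyond `b` it
    -- crosses at `b`, and behind `0` it goes through `0`.
    rcases hz1 with rfl | rfl
    · rcases le_or_gt z1 β with hle | hlt
      · refine ⟨ρ ^ 2, 1, one_pos, fun ε hε => ⟨z1 / β, ⟨by positivity, (div_le_one hβ).2 hle⟩,
          0, √((ε * p1 - z1) ^ 2 + (ε * p2) ^ 2), le_rfl, Real.sqrt_nonneg _, ?_, ?_, ?_⟩⟩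
        · rw [eu, div_mul_cancel₀ _ hβ.ne']; simp
        · rw [ev, div_mul_cancel₀ _ hβ.ne', Real.sq_sqrt (by positivity)]
        · rw [zero_add, Real.sq_sqrt (by positivity), h3]
          nlinarith [mul_le_mul_of_nonneg_left hrq hε.1.le]
      · have hr' : r = z1 - β := by
          rw [zero_pow two_ne_zero, add_zero] at h2
          exact (sq_eq_sq₀ hr (by linarith)).1 h2
        obtain ⟨h, hh⟩ : ∃ h, h = |p1| + ρ ^ 2 / (2 * β) := ⟨_, rfl⟩
        refine ⟨h ^ 2 + z1 * ρ ^ 2 / β, 1, one_pos, fun ε hε => ⟨1, by simp,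
          r, (β ^ 2 + ((ε * p1 - β) ^ 2 + (ε * p2) ^ 2)) / (2 * β), hr, by positivity, ?_, ?_, ?_⟩⟩
        · simp
        · rw [ev, one_mul, div_pow, le_div_iff₀ (by positivity)]
          nlinarith [sq_nonneg (β ^ 2 - ((ε * p1 - β) ^ 2 + (ε * p2) ^ 2))]
        · have e1 : r + (β ^ 2 + ((ε * p1 - β) ^ 2 + (ε * p2) ^ 2)) / (2 * β) =
              z1 + ε * (- p1 + ρ ^ 2 / (2 * β) * ε) := by
            rw [hr', h3]; field_simp; ring
          rw [e1]
          set k := - p1 + ρ ^ 2 / (2 * β) * ε with hk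
          have hle : |k| ≤ h := by
            rw [hh]
            refine (abs_add_le _ _).trans (add_le_add (abs_neg _).le ?_)
            rw [abs_of_nonneg (mul_nonneg (by positivity) hε.1.le)]
            exact mul_le_of_le_one_right (by positivity) hε.2.le
          have hsq : k ^ 2 ≤ h ^ 2 := by
            rw [← sq_abs k]; exact pow_le_pow_left₀ (abs_nonneg _) hle 2
          have e3 : (z1 + ε * k) ^ 2 = z1 ^ 2 + ε * (- 2 * p1 * z1) + z1 * ρ ^ 2 / β * ε ^ 2
              + ε ^ 2 * k ^ 2 := by
            rw [hk]; field_simp; ring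
          rw [e3]
          have e4 := mul_le_mul_of_nonneg_left hsq (sq_nonneg ε)
          have e6 : -2 * p1 * z1 ≤ (r + q) ^ 2 - z1 ^ 2 - ρ ^ 2 := by
            rw [h3]; linarith
          have e5 := mul_le_mul_of_nonneg_left e6 hε.1.le
          linarith
    · refine planar_hinge_of_add_le hζ hρ ?_
      have hr' : r = ζ + β := by
        refine (sq_eq_sq₀ hr (by linarith)).1 ?_
        rw [h2]; ring
      have : ρ ≤ β + q := by
        refine (abs_le_of_sq_le_sq' ?_ (by positivity)).2
        have : p1 - β ≤ q := (abs_le_of_sq_le_sq' (by nlinarith) hq).2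
        nlinarith
      linarith

section Gluing

variable {α : Type*} [MetricSpace α]

theorem exists_planar_coords {β ζ r : ℝ} (hβ : 0 < β) (h1 : ζ ≤ β + r) (h2 : β ≤ ζ + r)
    (h3 : r ≤ β + ζ) : ∃ z1 z2 : ℝ, 0 ≤ z2 ∧ ζ ^ 2 = z1 ^ 2 + z2 ^ 2 ∧
      r ^ 2 = (z1 - β) ^ 2 + z2 ^ 2 := by
  obtain ⟨z1, hz1⟩ : ∃ z1, z1 = (ζ ^ 2 + β ^ 2 - r ^ 2) / (2 * β) := ⟨_, rfl⟩
  have hz : z1 * (2 * β) = ζ ^ 2 + β ^ 2 - r ^ 2 := by rw [hz1]; field_simp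
  have hζ : 0 ≤ ζ := by linarith
  have hnn : 0 ≤ ζ ^ 2 - z1 ^ 2 := by
    have : |z1| ≤ ζ := by
      rw [abs_le]
      constructor
      · refine le_of_mul_le_mul_right ?_ (show 0 < 2 * β by positivity)
        rw [hz]; nlinarith
      · refine le_of_mul_le_mul_right ?_ (show 0 < 2 * β by positivity)
        rw [hz]; nlinarith
    have := pow_le_pow_left₀ (abs_nonneg _) this 2
    rw [sq_abs] at this
    linarith
  refine ⟨z1, √(ζ ^ 2 - z1 ^ 2), Real.sqrt_nonneg _, ?_, ?_⟩
  · rw [Real.sq_sqrt hnn]; ring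
  · rw [Real.sq_sqrt hnn]; nlinarith

/-- Two `CAT(0)` subsets that meet in a convex subset, which all geodesics from one to the other
have to cross. -/
structure Glueable (Y Z : Set α) : Prop where
  left : IsCAT0 Y
  right : IsCAT0 Z
  convex : ∀ p ∈ Y ∩ Z, ∀ q ∈ Y ∩ Z, ∀ t ∈ Icc (0 : ℝ) 1, ∃ m ∈ Y ∩ Z, IsPt p q t m
  cross : ∀ y ∈ Y, ∀ z ∈ Z, ∃ c ∈ Y ∩ Z, dist y z = dist y c + dist c z

theorem Glueable.symm {Y Z : Set α} (h : Glueable Y Z) : Glueable Z Y where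
  left := h.right
  right := h.left
  convex := by rw [inter_comm]; exact h.convex
  cross z hz y hy := by
    obtain ⟨c, hc, e⟩ := h.cross y hy z hz
    exact ⟨c, hc.symm, by rw [dist_comm z y, e, dist_comm z c, dist_comm c y, add_comm]⟩

/-- The geodesic from `p` to `z` crosses at some `b`. Comparison triangles for `a, b, z` and `a, b,
p` are laid on opposite sides of the segment `ab`, and `planar_hinge` selects a point of that
segment. The corresponding point `e` of `Y ∩ Z` is within the planar distances of `z` and `w`, by
comparison in `Z` and, twice, in `Y`. -/
theorem Glueable.hinge {Y Z : Set α} (h : Glueable Y Z) {a p z : α} (ha : a ∈ Y ∩ Z) (hp : p ∈ Y)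
    (hz : z ∈ Z) : Hinge Y a p z := by
  obtain ⟨b, hb, hpz⟩ := h.cross p hp z hz
  rw [dist_comm p b, dist_comm b z, add_comm] at hpz
  rcases (dist_nonneg (x := a) (y := b)).lt_or_eq with hβ | hβ
  swap
  · obtain rfl : a = b := dist_eq_zero.1 hβ.symm
    refine ⟨dist a p ^ 2, 1, one_pos, fun ε hε w hw hpt => ?_⟩
    have h1 : dist z w ≤ dist z a + ε * dist a p := hpt.1 ▸ dist_triangle z a w
    have h2 := pow_le_pow_left₀ dist_nonneg h1 2
    rw [hpz, dist_comm a z]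
    nlinarith
  obtain ⟨z1, z2, hz2, e1, e2⟩ := exists_planar_coords (ζ := dist z a) (r := dist z b) hβ
    (by rw [dist_comm a b]; linarith [dist_triangle z b a])
    (by linarith [dist_triangle a z b, dist_comm a z])
    (by linarith [dist_triangle z a b])
  obtain ⟨p1, p2, hp2, e3, e4⟩ := exists_planar_coords (ζ := dist a p) (r := dist b p) hβ
    (by linarith [dist_triangle a b p])
    (by linarith [dist_triangle a p b, dist_comm b p])
    (by linarith [dist_triangle b a p, dist_comm a b])
  obtain ⟨K, ε₀, h0, H⟩ := planar_hinge hβ hz2 hp2 dist_nonneg dist_nonneg dist_nonneg dist_nonneg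
    e1 e2 e3 e4
  refine ⟨K, min 1 ε₀, lt_min one_pos h0, fun ε hε w hw hpt => ?_⟩
  have hε1 := lt_min_iff.1 hε.2
  obtain ⟨s, hs, u, v, hu, hv, hu', hv', huv⟩ := H ε ⟨hε.1, hε1.2⟩
  obtain ⟨e, he, hse⟩ := h.convex a ha b hb s hs
  have c1 := h.right.cnAt a ha.2 b hb.2 e he.2 z hz s hs hse
  have c2 := h.left.cnAt a ha.1 b hb.1 e he.1 w hw s hs hse
  have c3 := h.left.cnAt a ha.1 p hp w hw b hb.1 ε ⟨hε.1.le, hε1.1.le⟩ hpt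
  unfold CNAt at c1 c2 c3
  rw [dist_comm w a, hpt.1, dist_comm w b] at c2
  rw [dist_comm b a] at c3
  have d1 : dist z e ≤ u := (abs_le_of_sq_le_sq' (c1.trans hu') hu).2
  have d2 : dist w e ≤ v := by
    refine (abs_le_of_sq_le_sq' ((c2.trans ?_).trans hv') hv).2
    have := mul_le_mul_of_nonneg_left c3 hs.1
    linarith
  have d3 : dist z w ≤ u + v := by
    have := dist_triangle z e w
    rw [dist_comm e w] at this
    linarith
  have := pow_le_pow_left₀ dist_nonneg d3 2
  rw [hpz, dist_comm a z]
  linarith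

theorem CNAt.of_dist_eq_zero {p q m z : α} {t : ℝ} (h : IsPt p q t m)
    (h0 : dist p m = 0 ∨ dist m q = 0) : CNAt p q t m z := by
  unfold CNAt
  rcases h0 with h0 | h0
  · have := dist_eq_zero.1 h0
    subst this
    rcases mul_eq_zero.1 (h.1.symm.trans h0) with rfl | h1
    · simp
    · rw [h1, dist_eq_zero.1 h1]; linarith
  · have := dist_eq_zero.1 h0
    subst this
    rcases mul_eq_zero.1 (h.2.symm.trans h0) with h1 | h1
    · obtain rfl : t = 1 := by linarith
      simp
    · rw [h1, dist_eq_zero.1 h1]; linarith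

/-- The comparison inequality at an interior point of a geodesic follows from the first order
comparison inequality for the geodesics that start there. -/
theorem cnAt_of_hinge {S : Set α} {p q c z : α} {t : ℝ} (hc : IsPt p q t c)
    (hA : 0 < dist p c) (hB : 0 < dist c q) (hp : Hinge S c z p) (hq : Hinge S c z q)
    (hex : ∀ ε ∈ Ioo (0 : ℝ) 1, ∃ w ∈ S, IsPt c z ε w) : CNAt p q t c z := by
  have hpq : dist p q = dist p c + dist c q := by rw [hc.1, hc.2]; ring
  have := cn_of_hinge hpq hA hB hp hq hex
  have hD : 0 < dist p q := by linarith
  rw [← hpq, hc.1, hc.2] at this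
  refine le_of_mul_le_mul_left ?_ hD
  nlinarith

/-- Let the geodesic from `m` to `z` cross at `c`. Comparison at `c` between `m` and `z`, seen from
`p` and from `q`, bounds `d(c, p)` and `d(c, q)`; inserting this into the comparison at `m` seen
from `c`, which takes place in `Y`, gives the one seen from `z`. -/
theorem Glueable.cnAt_left {Y Z : Set α} (h : Glueable Y Z) {p q m z : α} {t : ℝ} (hp : p ∈ Y)
    (hq : q ∈ Y) (hm : m ∈ Y) (hz : z ∈ Z) (ht : t ∈ Icc (0 : ℝ) 1) (hpt : IsPt p q t m) :
    CNAt p q t m z := by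
  by_cases h0 : dist p m = 0 ∨ dist m q = 0
  · exact CNAt.of_dist_eq_zero hpt h0
  push Not at h0
  have hA : 0 < dist p m := lt_of_le_of_ne dist_nonneg (Ne.symm h0.1)
  have hB : 0 < dist m q := lt_of_le_of_ne dist_nonneg (Ne.symm h0.2)
  obtain ⟨c, hc, hcr⟩ := h.cross m hm z hz
  by_cases hcm : c = m
  · subst hcm
    exact cnAt_of_hinge hpt hA hB (h.symm.hinge hc.symm hz hp) (h.symm.hinge hc.symm hz hq)
      fun ε hε => h.right.exists_isPt c hc.2 z hz ε ⟨hε.1.le, hε.2.le⟩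
  by_cases hcz : c = z
  · subst hcz
    exact h.left.cnAt p hp q hq m hm c hc.1 t ht hpt
  have hx : 0 < dist m c := dist_pos.2 (Ne.symm hcm)
  have hy : 0 < dist c z := dist_pos.2 hcz
  have hex : ∀ p ∈ Y, ∀ ε ∈ Ioo (0 : ℝ) 1, ∃ w ∈ Y, IsPt c p ε w :=
    fun p hp ε hε => h.left.exists_isPt c hc.1 p hp ε ⟨hε.1.le, hε.2.le⟩
  have tp := cn_of_hinge hcr hx hy (h.left.hinge hc.1 hp hm) (h.hinge hc hp hz) (hex p hp)
  have tq := cn_of_hinge hcr hx hy (h.left.hinge hc.1 hq hm) (h.hinge hc hq hz) (hex q hq)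
  have tc := h.left.cnAt p hp q hq m hm c hc.1 t ht hpt
  unfold CNAt at *
  rw [hpt.1, dist_comm p z] at tp
  rw [dist_comm q m, hpt.2, dist_comm q z] at tq
  rw [dist_comm c m, dist_comm c p, dist_comm c q] at tc
  rw [dist_comm z m, hcr]
  set x := dist m c
  set y := dist c z
  have ht1 : 0 ≤ 1 - t := by linarith [ht.2]
  have t1 := mul_le_mul_of_nonneg_left tp ht1
  have t2 := mul_le_mul_of_nonneg_left tq ht.1
  have t3 := mul_le_mul_of_nonneg_left tc (by positivity : 0 ≤ x + y)
  refine le_of_mul_le_mul_left ?_ hx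
  nlinarith

theorem CNAt.symm {p q m z : α} {t : ℝ} (h : CNAt p q t m z) : CNAt q p (1 - t) m z := by
  unfold CNAt at *
  rw [dist_comm q p]
  linarith

theorem CNAt.comp {p q c m z : α} {s t : ℝ} (hc : IsPt p q t c) (h : CNAt p q t c z) (hs : 0 ≤ s)
    (h' : CNAt p c s m z) : CNAt p q (s * t) m z := by
  unfold CNAt at *
  rw [hc.1] at h'
  nlinarith [mul_le_mul_of_nonneg_left h hs]

theorem Glueable.exists_cnAt_left {Y Z : Set α} (h : Glueable Y Z) {p q : α} (hp : p ∈ Y)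
    (hq : q ∈ Y) {t : ℝ} (ht : t ∈ Icc (0 : ℝ) 1) :
    ∃ m ∈ Y ∪ Z, ∀ z ∈ Y ∪ Z, CNAt p q t m z := by
  obtain ⟨m, hm, hpt⟩ := h.left.exists_isPt p hp q hq t ht
  refine ⟨m, Or.inl hm, ?_⟩
  rintro z (hz | hz)
  · exact h.left.cnAt p hp q hq m hm z hz t ht hpt
  · exact h.cnAt_left hp hq hm hz ht hpt

/-- The hinges give comparison at the crossing point `c`. Every other parameter belongs to one of
the two halves, which lie on one side each, and there `CNAt.comp` combines the comparison inside the
half with that at `c`. -/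
theorem Glueable.exists_cnAt_left_right {Y Z : Set α} (h : Glueable Y Z) {p q : α} (hp : p ∈ Y)
    (hq : q ∈ Z) {t : ℝ} (ht : t ∈ Icc (0 : ℝ) 1) :
    ∃ m ∈ Y ∪ Z, ∀ z ∈ Y ∪ Z, CNAt p q t m z := by
  obtain ⟨c, hc, hpq⟩ := h.cross p hp q hq
  by_cases hpc : p = c
  · subst hpc
    rw [union_comm]
    exact h.symm.exists_cnAt_left hc.2 hq ht
  by_cases hcq : c = q
  · subst hcq
    exact h.exists_cnAt_left hp hc.1 ht
  have hA : 0 < dist p c := dist_pos.2 hpc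
  have hB : 0 < dist c q := dist_pos.2 hcq
  obtain ⟨t₀, ht₀⟩ : ∃ t₀, t₀ = dist p c / dist p q := ⟨_, rfl⟩
  have hD : 0 < dist p q := by linarith
  have h0 : 0 < t₀ := ht₀ ▸ div_pos hA hD
  have h1 : 0 < 1 - t₀ := by
    rw [ht₀, sub_pos, div_lt_one hD]; linarith
  have hpc' : IsPt p q t₀ c := by
    have : t₀ * dist p q = dist p c := by rw [ht₀, div_mul_cancel₀ _ hD.ne']
    exact ⟨this.symm, by linarith⟩
  have hcn : ∀ z ∈ Y ∪ Z, CNAt p q t₀ c z := by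
    rintro z (hz | hz)
    · exact cnAt_of_hinge hpc' hA hB (h.left.hinge hc.1 hz hp) (h.hinge hc hz hq)
        fun ε hε => h.left.exists_isPt c hc.1 z hz ε ⟨hε.1.le, hε.2.le⟩
    · exact cnAt_of_hinge hpc' hA hB (h.symm.hinge hc.symm hz hp) (h.right.hinge hc.2 hz hq)
        fun ε hε => h.right.exists_isPt c hc.2 z hz ε ⟨hε.1.le, hε.2.le⟩
  rcases le_total t t₀ with hle | hle
  · obtain ⟨m, hm, hmz⟩ := h.exists_cnAt_left hp hc.1 (t := t / t₀)
      ⟨div_nonneg ht.1 h0.le, (div_le_one h0).2 hle⟩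
    refine ⟨m, hm, fun z hz => ?_⟩
    have := (hcn z hz).comp hpc' (div_nonneg ht.1 h0.le) (hmz z hz)
    rwa [div_mul_cancel₀ _ h0.ne'] at this
  · have hs : 0 ≤ (1 - t) / (1 - t₀) := div_nonneg (by linarith [ht.2]) h1.le
    obtain ⟨m, hm, hmz⟩ := h.symm.exists_cnAt_left hq hc.2 (t := (1 - t) / (1 - t₀))
      ⟨hs, (div_le_one h1).2 (by linarith)⟩
    rw [union_comm] at hm hmz
    refine ⟨m, hm, fun z hz => ?_⟩
    have := (hcn z hz).symm.comp hpc'.symm hs (hmz z hz)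
    rw [div_mul_cancel₀ _ h1.ne'] at this
    have := this.symm
    rwa [sub_sub_cancel] at this

/-- **Gluing theorem.** -/
theorem Glueable.isCAT0_union {Y Z : Set α} (h : Glueable Y Z) : IsCAT0 (Y ∪ Z) := by
  refine IsCAT0.of_exists ?_
  rintro p (hp | hp) q (hq | hq) t ht
  · exact h.exists_cnAt_left hp hq ht
  · exact h.exists_cnAt_left_right hp hq ht
  · rw [union_comm]; exact h.symm.exists_cnAt_left_right hp hq ht
  · rw [union_comm]; exact h.symm.exists_cnAt_left hp hq ht

end Gluing

/-! ### Supports and adjacency -/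

namespace OrthantSpace

variable {M m : ℕ} (X : OrthantSpace M m)

/-- The indices of the non-zero coordinates of a vector. -/
noncomputable def supp (x : EuclideanSpace ℝ (Fin M)) : Finset (Fin M) := Finset.univ.filter fun i => x i ≠ 0

@[simp]
theorem mem_supp {x : EuclideanSpace ℝ (Fin M)} {i : Fin M} : i ∈ supp x ↔ x i ≠ 0 := by
  simp [supp]

theorem supp_eq_of_mem_orthant {E : Finset (Fin M)} {x : EuclideanSpace ℝ (Fin M)}
    (h : x ∈ orthant E) : supp x = E := by
  ext i
  rw [mem_supp]
  refine ⟨fun hi => ?_, fun hi => (h.1 i hi).ne'⟩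
  by_contra hE
  exact hi (h.2 i hE)

theorem nonneg_of_mem_orthant {E : Finset (Fin M)} {x : EuclideanSpace ℝ (Fin M)}
    (h : x ∈ orthant E) (i : Fin M) : 0 ≤ x i := by
  by_cases hi : i ∈ E
  · exact (h.1 i hi).le
  · exact (h.2 i hi).ge

theorem mem_orthant_supp {x : EuclideanSpace ℝ (Fin M)} (h : ∀ i, 0 ≤ x i) :
    x ∈ orthant (supp x) :=
  ⟨fun i hi => lt_of_le_of_ne (h i) (Ne.symm (mem_supp.1 hi)), fun i hi => by simpa using hi⟩

variable {X} in
theorem mem_carrier {x : EuclideanSpace ℝ (Fin M)} :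
    x ∈ X.carrier ↔ (∀ i, 0 ≤ x i) ∧ supp x ∈ X.faces := by
  simp only [carrier, mem_iUnion, exists_prop]
  constructor
  · rintro ⟨E, hE, hx⟩
    exact ⟨nonneg_of_mem_orthant hx, (supp_eq_of_mem_orthant hx).symm ▸ hE⟩
  · rintro ⟨h, hs⟩
    exact ⟨_, hs, mem_orthant_supp h⟩

/-- Two points of `X` in the closure of a common orthant. -/
def Adj (x y : EuclideanSpace ℝ (Fin M)) : Prop :=
  (∀ i, 0 ≤ x i) ∧ (∀ i, 0 ≤ y i) ∧ supp x ∪ supp y ∈ X.faces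

variable {X}

theorem Adj.symm {x y : EuclideanSpace ℝ (Fin M)} (h : X.Adj x y) : X.Adj y x :=
  ⟨h.2.1, h.1, by rw [Finset.union_comm]; exact h.2.2⟩

theorem Adj.left_mem {x y : EuclideanSpace ℝ (Fin M)} (h : X.Adj x y) : x ∈ X.carrier :=
  mem_carrier.2 ⟨h.1, X.down_closed _ h.2.2 _ Finset.subset_union_left⟩

theorem Adj.right_mem {x y : EuclideanSpace ℝ (Fin M)} (h : X.Adj x y) : y ∈ X.carrier :=
  h.symm.left_mem

theorem adj_of_supp_subset {x y : EuclideanSpace ℝ (Fin M)} (hx : ∀ i, 0 ≤ x i)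
    (hy : y ∈ X.carrier) (h : supp x ⊆ supp y) : X.Adj x y := by
  rw [mem_carrier] at hy
  exact ⟨hx, hy.1, by rw [Finset.union_eq_right.2 h]; exact hy.2⟩

theorem adj_self {x : EuclideanSpace ℝ (Fin M)} (hx : x ∈ X.carrier) : X.Adj x x :=
  adj_of_supp_subset (mem_carrier.1 hx).1 hx (Finset.Subset.refl _)

theorem supp_zero : supp (0 : EuclideanSpace ℝ (Fin M)) = ∅ := by
  ext i; simp

theorem adj_zero_left {x : EuclideanSpace ℝ (Fin M)} (hx : x ∈ X.carrier) : X.Adj 0 x :=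
  adj_of_supp_subset (fun i => le_rfl) hx (by rw [supp_zero]; exact Finset.empty_subset _)

theorem supp_segment_subset {x y z : EuclideanSpace ℝ (Fin M)} (hz : z ∈ segment ℝ x y) :
    supp z ⊆ supp x ∪ supp y := by
  obtain ⟨a, b, -, -, -, rfl⟩ := hz
  intro i hi
  rw [Finset.mem_union, mem_supp, mem_supp]
  rw [mem_supp] at hi
  by_contra! h
  exact hi (by simp [h.1, h.2])

theorem Adj.segment_subset {x y : EuclideanSpace ℝ (Fin M)} (h : X.Adj x y) :
    segment ℝ x y ⊆ X.carrier := by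
  intro z hz
  refine mem_carrier.2 ⟨fun i => ?_, X.down_closed _ h.2.2 _ (supp_segment_subset hz)⟩
  obtain ⟨a, b, ha, hb, -, rfl⟩ := hz
  have := mul_nonneg ha (h.1 i)
  have := mul_nonneg hb (h.2.1 i)
  simp
  linarith

/-- The midpoint of two non-negative vectors has the union of their supports as its support. -/
theorem adj_of_segment_subset {x y : EuclideanSpace ℝ (Fin M)}
    (h : segment ℝ x y ⊆ X.carrier) : X.Adj x y := by
  have hx := mem_carrier.1 (h (left_mem_segment ℝ x y))
  have hy := mem_carrier.1 (h (right_mem_segment ℝ x y))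
  refine ⟨hx.1, hy.1, ?_⟩
  have hm := (mem_carrier.1 (h (midpoint_mem_segment x y))).2
  convert hm using 1
  ext i
  have := hx.1 i
  have := hy.1 i
  simp only [Finset.mem_union, mem_supp, midpoint_eq_smul_add, PiLp.smul_apply, PiLp.add_apply,
    smul_eq_mul]
  constructor
  · rintro (h | h)
    · have := lt_of_le_of_ne (hx.1 i) (Ne.symm h); norm_num; linarith
    · have := lt_of_le_of_ne (hy.1 i) (Ne.symm h); norm_num; linarith
  · intro h
    by_contra! h'
    exact h (by simp [h'.1, h'.2])

theorem Adj.of_mem_segment {x y u v : EuclideanSpace ℝ (Fin M)} (h : X.Adj x y)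
    (hu : u ∈ segment ℝ x y) (hv : v ∈ segment ℝ x y) : X.Adj u v :=
  adj_of_segment_subset (((convex_segment x y).segment_subset hu hv).trans h.segment_subset)

/-! ### The intrinsic metric -/

variable (X) in
/-- `Chain X x y L`: there is a piecewise linear path of length `L` in `X` from `x` to `y`. -/
inductive Chain : EuclideanSpace ℝ (Fin M) → EuclideanSpace ℝ (Fin M) → ℝ → Prop
  | nil (x) : x ∈ X.carrier → Chain x x 0
  | cons (x y z L) : X.Adj x y → Chain y z L → Chain x z (dist x y + L)

theorem Chain.isPathLength {x y : EuclideanSpace ℝ (Fin M)} {L : ℝ} (h : X.Chain x y L) :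
    X.IsPathLength x y L := by
  induction h with
  | nil x hx => exact ⟨0, fun _ => x, rfl, rfl, by simp, by simp⟩
  | cons x y z L hxy _ ih =>
    obtain ⟨n, p, h0, hn, hseg, rfl⟩ := ih
    refine ⟨n + 1, fun i => Nat.casesOn i x p, rfl, hn, ?_, ?_⟩
    · rintro (_ | i) hi
      · change segment ℝ x (p 0) ⊆ _
        rw [h0]; exact hxy.segment_subset
      · exact hseg i (by omega)
    · rw [Finset.sum_range_succ']
      change _ = _ + dist x (p 0)
      rw [h0, add_comm]

theorem IsPathLength.chain {x y : EuclideanSpace ℝ (Fin M)} {L : ℝ} (h : X.IsPathLength x y L)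
    (hx : x ∈ X.carrier) : X.Chain x y L := by
  obtain ⟨n, p, h0, hn, hseg, rfl⟩ := h
  induction n generalizing x p with
  | zero => subst h0; subst hn; simpa using Chain.nil _ hx
  | succ n ih =>
    rw [Finset.sum_range_succ', add_comm, zero_add, h0]
    have hadj : X.Adj x (p 1) := h0 ▸ adj_of_segment_subset (hseg 0 (by omega))
    exact Chain.cons x (p 1) y _ hadj
      (ih hadj.right_mem (fun i => p (i + 1)) rfl hn fun i hi => hseg (i + 1) (by omega))

theorem Chain.left_mem {x y : EuclideanSpace ℝ (Fin M)} {L : ℝ} (h : X.Chain x y L) :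
    x ∈ X.carrier := by
  cases h with
  | nil _ hx => exact hx
  | cons _ _ _ _ hxy _ => exact hxy.left_mem

theorem Chain.dist_le {x y : EuclideanSpace ℝ (Fin M)} {L : ℝ} (h : X.Chain x y L) :
    dist x y ≤ L := by
  induction h with
  | nil x hx => simp
  | cons x y z L hxy _ ih => linarith [dist_triangle x y z]

theorem Adj.chain {x y : EuclideanSpace ℝ (Fin M)} (h : X.Adj x y) : X.Chain x y (dist x y) := by
  simpa using Chain.cons x y y 0 h (Chain.nil y h.right_mem)

theorem Chain.trans {x y z : EuclideanSpace ℝ (Fin M)} {L L' : ℝ} (h : X.Chain x y L)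
    (h' : X.Chain y z L') : X.Chain x z (L + L') := by
  induction h with
  | nil x hx => simpa using h'
  | cons x y w L hxy _ ih => rw [add_assoc]; exact Chain.cons _ _ _ _ hxy (ih h')

theorem Chain.symm {x y : EuclideanSpace ℝ (Fin M)} {L : ℝ} (h : X.Chain x y L) :
    X.Chain y x L := by
  induction h with
  | nil x hx => exact Chain.nil x hx
  | cons x y w L hxy _ ih =>
    rw [add_comm, dist_comm]
    exact ih.trans hxy.symm.chain

theorem exists_chain {x y : EuclideanSpace ℝ (Fin M)} (hx : x ∈ X.carrier) (hy : y ∈ X.carrier) :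
    ∃ L, X.Chain x y L :=
  ⟨_, (adj_zero_left hx).symm.chain.trans (adj_zero_left hy).chain⟩

theorem bddBelow_isPathLength (x y : EuclideanSpace ℝ (Fin M)) :
    BddBelow {L | X.IsPathLength x y L} := by
  refine ⟨0, ?_⟩
  rintro L ⟨n, p, -, -, -, rfl⟩
  exact Finset.sum_nonneg fun i _ => dist_nonneg

theorem Chain.idist_le {x y : EuclideanSpace ℝ (Fin M)} {L : ℝ} (h : X.Chain x y L) :
    X.idist x y ≤ L :=
  csInf_le (bddBelow_isPathLength x y) h.isPathLength

theorem le_idist {x y : EuclideanSpace ℝ (Fin M)} (hx : x ∈ X.carrier) (hy : y ∈ X.carrier)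
    {a : ℝ} (h : ∀ L, X.Chain x y L → a ≤ L) : a ≤ X.idist x y := by
  obtain ⟨L, hL⟩ := exists_chain hx hy
  exact le_csInf ⟨L, hL.isPathLength⟩ fun L' hL' => h L' (IsPathLength.chain hL' hx)

theorem exists_chain_lt {x y : EuclideanSpace ℝ (Fin M)} (hx : x ∈ X.carrier)
    (hy : y ∈ X.carrier) {a : ℝ} (ha : X.idist x y < a) : ∃ L < a, X.Chain x y L := by
  by_contra! h
  refine absurd (le_idist hx hy fun L hL => ?_) (not_le.2 ha)
  by_contra! hlt
  exact h L hlt hL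

theorem dist_le_idist {x y : EuclideanSpace ℝ (Fin M)} (hx : x ∈ X.carrier)
    (hy : y ∈ X.carrier) : dist x y ≤ X.idist x y :=
  le_idist hx hy fun _ hL => hL.dist_le

theorem Adj.idist_eq {x y : EuclideanSpace ℝ (Fin M)} (h : X.Adj x y) : X.idist x y = dist x y :=
  le_antisymm h.chain.idist_le (dist_le_idist h.left_mem h.right_mem)

theorem idist_comm {x y : EuclideanSpace ℝ (Fin M)} (hx : x ∈ X.carrier)
    (hy : y ∈ X.carrier) : X.idist x y = X.idist y x :=
  le_antisymm (le_idist hy hx fun _ hL => hL.symm.idist_le)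
    (le_idist hx hy fun _ hL => hL.symm.idist_le)

theorem idist_triangle {x y z : EuclideanSpace ℝ (Fin M)} (hx : x ∈ X.carrier)
    (hy : y ∈ X.carrier) (hz : z ∈ X.carrier) : X.idist x z ≤ X.idist x y + X.idist y z := by
  rw [← sub_le_iff_le_add]
  refine le_idist hx hy fun L hL => ?_
  rw [sub_le_comm]
  refine le_idist hy hz fun L' hL' => ?_
  rw [sub_le_iff_le_add']
  exact (hL.trans hL').idist_le

variable (X) in
/-- The points of `X`, with the intrinsic metric. -/
@[ext]
structure IPoint where
  /-- the point as a vector -/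
  val : EuclideanSpace ℝ (Fin M)
  /-- the vector lies in `X` -/
  mem : val ∈ X.carrier

noncomputable instance : MetricSpace X.IPoint where
  dist x y := X.idist x.1 y.1
  dist_self x := by
    rw [(adj_self x.2).idist_eq, dist_self]
  dist_comm x y := idist_comm x.2 y.2
  dist_triangle x y z := idist_triangle x.2 y.2 z.2
  eq_of_dist_eq_zero {x y} h := by
    refine IPoint.ext (dist_le_zero.1 ?_)
    exact (dist_le_idist x.2 y.2).trans h.le

theorem IPoint.dist_def (x y : X.IPoint) : dist x y = X.idist x.1 y.1 := rfl

theorem IPoint.dist_val_le (x y : X.IPoint) : dist x.1 y.1 ≤ dist x y := dist_le_idist x.2 y.2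

theorem Adj.dist_eq {x y : X.IPoint} (h : X.Adj x.1 y.1) : dist x y = dist x.1 y.1 := h.idist_eq

/-! ### Coordinate projections -/

@[simp]
theorem proj_apply (S : Finset (Fin M)) (x : EuclideanSpace ℝ (Fin M)) (i : Fin M) :
    proj S x i = if i ∈ S then x i else 0 := rfl

theorem supp_proj (S : Finset (Fin M)) (x : EuclideanSpace ℝ (Fin M)) :
    supp (proj S x) = supp x ∩ S := by
  ext i; simp; tauto

theorem dist_proj_le (S : Finset (Fin M)) (x y : EuclideanSpace ℝ (Fin M)) :
    dist (proj S x) (proj S y) ≤ dist x y := by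
  rw [EuclideanSpace.dist_eq, EuclideanSpace.dist_eq]
  refine Real.sqrt_le_sqrt (Finset.sum_le_sum fun i _ => ?_)
  by_cases hi : i ∈ S <;> simp [hi]

theorem proj_nonneg (S : Finset (Fin M)) {x : EuclideanSpace ℝ (Fin M)} (h : ∀ i, 0 ≤ x i)
    (i : Fin M) : 0 ≤ proj S x i := by
  rw [proj_apply]; split_ifs
  exacts [h i, le_rfl]

theorem Adj.proj {x y : EuclideanSpace ℝ (Fin M)} (h : X.Adj x y) (S : Finset (Fin M)) :
    X.Adj (OrthantSpace.proj S x) (OrthantSpace.proj S y) := by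
  refine ⟨proj_nonneg S h.1, proj_nonneg S h.2.1, X.down_closed _ h.2.2 _ ?_⟩
  rw [supp_proj, supp_proj]
  exact Finset.union_subset_union Finset.inter_subset_left Finset.inter_subset_left

theorem proj_mem_carrier {x : EuclideanSpace ℝ (Fin M)} (h : x ∈ X.carrier) (S : Finset (Fin M)) :
    proj S x ∈ X.carrier :=
  ((adj_self h).proj S).left_mem

theorem Chain.proj {x y : EuclideanSpace ℝ (Fin M)} {L : ℝ} (h : X.Chain x y L)
    (S : Finset (Fin M)) :
    ∃ L' ≤ L, X.Chain (OrthantSpace.proj S x) (OrthantSpace.proj S y) L' := by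
  induction h with
  | nil x hx => exact ⟨0, le_rfl, Chain.nil _ (proj_mem_carrier hx S)⟩
  | cons x y z L hxy _ ih =>
    obtain ⟨L', hL', h'⟩ := ih
    exact ⟨_, add_le_add (dist_proj_le S x y) hL', Chain.cons _ _ _ _ (hxy.proj S) h'⟩

theorem idist_proj_le {x y : EuclideanSpace ℝ (Fin M)} (hx : x ∈ X.carrier) (hy : y ∈ X.carrier)
    (S : Finset (Fin M)) : X.idist (proj S x) (proj S y) ≤ X.idist x y :=
  le_idist hx hy fun _ hL => by
    obtain ⟨L', hL', h'⟩ := hL.proj S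
    exact h'.idist_le.trans hL'

theorem proj_eq_self {S : Finset (Fin M)} {x : EuclideanSpace ℝ (Fin M)} (h : supp x ⊆ S) :
    proj S x = x := by
  ext i
  rw [proj_apply]
  split_ifs with hi
  · rfl
  · by_contra h0
    exact hi (h (mem_supp.2 (Ne.symm h0)))

/-- The projection to a coordinate subcomplex, as a map of `X` to itself. -/
noncomputable def IPoint.proj (S : Finset (Fin M)) (x : X.IPoint) : X.IPoint :=
  ⟨OrthantSpace.proj S x.1, proj_mem_carrier x.2 S⟩

theorem IPoint.dist_proj_le (S : Finset (Fin M)) (x y : X.IPoint) :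
    dist (x.proj S) (y.proj S) ≤ dist x y :=
  idist_proj_le x.2 y.2 S

/-- The points of `X` all of whose non-zero coordinates have their indices in `S`. -/
def sub (X : OrthantSpace M m) (S : Finset (Fin M)) : Set X.IPoint := {x | supp x.1 ⊆ S}

theorem IPoint.proj_mem_sub (S : Finset (Fin M)) (x : X.IPoint) : x.proj S ∈ X.sub S := by
  change supp (OrthantSpace.proj S x.1) ⊆ S
  rw [supp_proj]; exact Finset.inter_subset_right

theorem IPoint.proj_eq_self {S : Finset (Fin M)} {x : X.IPoint} (h : x ∈ X.sub S) :
    x.proj S = x :=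
  IPoint.ext (OrthantSpace.proj_eq_self h)

/-- The projection fixes the end points and does not increase distances, so the image of an
intermediate point is again one. -/
theorem exists_isPt_sub {S T : Finset (Fin M)} (h : IsCAT0 (X.sub S)) (hTS : T ⊆ S) {p q : X.IPoint}
    (hp : p ∈ X.sub T) (hq : q ∈ X.sub T) {t : ℝ} (ht : t ∈ Icc (0 : ℝ) 1) :
    ∃ m ∈ X.sub T, IsPt p q t m := by
  obtain ⟨m, -, hm⟩ := h.exists_isPt p (hp.trans hTS) q (hq.trans hTS) t ht
  refine ⟨m.proj T, m.proj_mem_sub T, IsPt.of_le ?_ ?_⟩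
  · rw [← hm.1]
    conv_lhs => rw [← IPoint.proj_eq_self hp]
    exact IPoint.dist_proj_le T p m
  · rw [← hm.2]
    conv_lhs => rw [← IPoint.proj_eq_self hq]
    exact IPoint.dist_proj_le T m q

end OrthantSpace

namespace OrthantSpace

variable {M m : ℕ} {X : OrthantSpace M m}

/-! ### Local structure -/

theorem exists_radius {x : EuclideanSpace ℝ (Fin M)} (hx : ∀ i, 0 ≤ x i) :
    ∃ r > 0, ∀ i ∈ supp x, r ≤ x i := by
  rcases (supp x).eq_empty_or_nonempty with h | h
  · exact ⟨1, one_pos, by simp [h]⟩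
  · obtain ⟨i, hi, hmin⟩ := Finset.exists_min_image (supp x) x h
    exact ⟨x i, lt_of_le_of_ne (hx i) (Ne.symm (mem_supp.1 hi)), hmin⟩

theorem abs_sub_apply_le (x y : EuclideanSpace ℝ (Fin M)) (i : Fin M) :
    |x i - y i| ≤ dist x y := by
  rw [EuclideanSpace.dist_eq, ← Real.sqrt_sq_eq_abs]
  refine Real.sqrt_le_sqrt ?_
  have := Finset.single_le_sum (f := fun j => dist (x j) (y j) ^ 2) (fun j _ => sq_nonneg _)
    (Finset.mem_univ i)
  simpa [Real.dist_eq] using this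

theorem supp_subset_of_dist_lt {x y : EuclideanSpace ℝ (Fin M)} {r : ℝ}
    (hr : ∀ i ∈ supp x, r ≤ x i) (h : dist x y < r) : supp x ⊆ supp y := by
  intro i hi
  rw [mem_supp]
  intro h0
  have h1 := abs_sub_apply_le x y i
  have h2 := hr i hi
  rw [h0, sub_zero] at h1
  linarith [le_abs_self (x i)]

theorem isClosed_carrier : IsClosed X.carrier := by
  have : X.carrier = ⋃ E ∈ X.faces, {x | (∀ i, 0 ≤ x i) ∧ ∀ i, i ∉ E → x i = 0} := by
    ext x
    rw [mem_carrier]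
    simp only [mem_iUnion, exists_prop, mem_ofPred_eq]
    constructor
    · rintro ⟨h, hs⟩
      exact ⟨supp x, hs, h, fun i hi => by simpa using hi⟩
    · rintro ⟨E, hE, h, hs⟩
      refine ⟨h, X.down_closed E hE _ fun i hi => ?_⟩
      by_contra h'
      exact mem_supp.1 hi (hs i h')
  rw [this]
  refine Set.Finite.isClosed_biUnion (Set.toFinite _) fun E _ => ?_
  simp only [ofPred_and, ofPred_forall]
  refine IsClosed.inter (isClosed_iInter fun i => isClosed_le continuous_const (by fun_prop)) ?_
  exact isClosed_iInter fun i => isClosed_iInter fun _ => isClosed_eq (by fun_prop) continuous_const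

/-! ### The product structure of the star of a vertex -/

theorem sqrt_add_sqrt_eq {δ L h h' : ℝ} (hδ : 0 ≤ δ) (hL : 0 ≤ L) (h0 : 0 < δ + L) :
    √(δ ^ 2 + (h - (L * h + δ * h') / (δ + L)) ^ 2) + √(L ^ 2 + ((L * h + δ * h') / (δ + L) - h') ^ 2)
      = √((δ + L) ^ 2 + (h - h') ^ 2) := by
  obtain ⟨k, hk⟩ : ∃ k, k = (h - h') / (δ + L) := ⟨_, rfl⟩
  have e1 : h - (L * h + δ * h') / (δ + L) = δ * k := by rw [hk]; field_simp; ring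
  have e2 : (L * h + δ * h') / (δ + L) - h' = L * k := by rw [hk]; field_simp; ring
  have e3 : h - h' = (δ + L) * k := by rw [hk]; field_simp
  have key : ∀ a, 0 ≤ a → √(a ^ 2 + (a * k) ^ 2) = a * √(1 + k ^ 2) := fun a ha => by
    rw [show a ^ 2 + (a * k) ^ 2 = a ^ 2 * (1 + k ^ 2) by ring, Real.sqrt_mul (sq_nonneg a),
      Real.sqrt_sq ha]
  rw [e1, e2, e3, key _ hδ, key _ hL, key _ h0.le]
  ring

theorem dist_add_single_sq {v : Fin M} {x y : EuclideanSpace ℝ (Fin M)} (hx : x v = 0)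
    (hy : y v = 0) (a b : ℝ) :
    dist (x + EuclideanSpace.single v a) (y + EuclideanSpace.single v b) ^ 2
      = dist x y ^ 2 + (a - b) ^ 2 := by
  rw [EuclideanSpace.dist_eq, EuclideanSpace.dist_eq, Real.sq_sqrt (by positivity),
    Real.sq_sqrt (by positivity), ← Finset.add_sum_erase _ _ (Finset.mem_univ v),
    ← Finset.add_sum_erase (a := v) _ (fun i => dist (x i) (y i) ^ 2) (Finset.mem_univ v)]
  have : ∀ i ∈ Finset.univ.erase v, dist ((x + EuclideanSpace.single v a) i)
      ((y + EuclideanSpace.single v b) i) ^ 2 = dist (x i) (y i) ^ 2 := fun i hi => by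
    simp [(Finset.mem_erase.1 hi).1]
  rw [Finset.sum_congr rfl this]
  simp [hx, hy, Real.dist_eq]
  ring

theorem supp_add_single_subset {T : Finset (Fin M)} {v : Fin M} {x : EuclideanSpace ℝ (Fin M)}
    (hx : supp x ⊆ T) (a : ℝ) : supp (x + EuclideanSpace.single v a) ⊆ insert v T := by
  intro i hi
  by_cases hiv : i = v
  · simp [hiv]
  · refine Finset.mem_insert_of_mem (hx ?_)
    simpa [hiv] using hi

theorem add_single_nonneg {v : Fin M} {x : EuclideanSpace ℝ (Fin M)} (hx : ∀ i, 0 ≤ x i) {a : ℝ}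
    (ha : 0 ≤ a) (i : Fin M) : 0 ≤ (x + EuclideanSpace.single v a) i := by
  have := hx i
  by_cases hiv : i = v
  · subst hiv; simp; linarith
  · simpa [hiv] using this

section Star

variable {v : Fin M} {T : Finset (Fin M)}

theorem Adj.add_single (hT : ∀ F ∈ X.faces, F ⊆ T → insert v F ∈ X.faces)
    {x y : EuclideanSpace ℝ (Fin M)} (h : X.Adj x y) (hx : supp x ⊆ T) (hy : supp y ⊆ T)
    {a b : ℝ} (ha : 0 ≤ a) (hb : 0 ≤ b) :
    X.Adj (x + EuclideanSpace.single v a) (y + EuclideanSpace.single v b) := by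
  refine ⟨add_single_nonneg h.1 ha, add_single_nonneg h.2.1 hb, ?_⟩
  refine X.down_closed _ (hT _ h.2.2 (Finset.union_subset hx hy)) _ ?_
  exact Finset.union_subset
    (supp_add_single_subset Finset.subset_union_left a)
    (supp_add_single_subset Finset.subset_union_right b)

theorem supp_proj_subset (T : Finset (Fin M)) (x : EuclideanSpace ℝ (Fin M)) :
    supp (proj T x) ⊆ T := by
  rw [supp_proj]; exact Finset.inter_subset_right

theorem add_single_mem_carrier (hT : ∀ F ∈ X.faces, F ⊆ T → insert v F ∈ X.faces)
    {x : EuclideanSpace ℝ (Fin M)} (hx : x ∈ X.carrier) (hxT : supp x ⊆ T) {a : ℝ} (ha : 0 ≤ a) :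
    x + EuclideanSpace.single v a ∈ X.carrier :=
  ((adj_self hx).add_single hT hxT hxT ha ha).left_mem

/-- Lift the chain to the product with the `v`-axis, letting the height vary linearly with the
length travelled. All pieces then have the same slope, so their lengths add up without loss; this is
`sqrt_add_sqrt_eq`. -/
theorem idist_add_single_le_of_chain (hvT : v ∉ T)
    (hT : ∀ F ∈ X.faces, F ⊆ T → insert v F ∈ X.faces) {x y : EuclideanSpace ℝ (Fin M)} {L : ℝ}
    (h : X.Chain x y L) : ∀ a b : ℝ, 0 ≤ a → 0 ≤ b →
      X.idist (proj T x + EuclideanSpace.single v a) (proj T y + EuclideanSpace.single v b)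
        ≤ √(L ^ 2 + (a - b) ^ 2) := by
  have hv : ∀ x, proj T x v = 0 := fun x => by simp [hvT]
  induction h with
  | nil x hx =>
    intro a b ha hb
    have hadj := ((adj_self hx).proj T).add_single hT (supp_proj_subset T x)
      (supp_proj_subset T x) ha hb
    rw [hadj.idist_eq]
    refine Real.le_sqrt_of_sq_le ?_
    rw [dist_add_single_sq (hv x) (hv x)]
    simp
  | cons x y z L hxy hyz ih =>
    intro a b ha hb
    have hstep : ∀ a b : ℝ, 0 ≤ a → 0 ≤ b →
        X.idist (proj T x + EuclideanSpace.single v a) (proj T y + EuclideanSpace.single v b)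
        ≤ √(dist x y ^ 2 + (a - b) ^ 2) := by
      intro a b ha hb
      have hadj := (hxy.proj T).add_single hT (supp_proj_subset T x)
        (supp_proj_subset T y) ha hb
      rw [hadj.idist_eq]
      refine Real.le_sqrt_of_sq_le ?_
      rw [dist_add_single_sq (hv x) (hv y)]
      gcongr
      exact dist_proj_le T x y
    have htri : ∀ g : ℝ, 0 ≤ g →
        X.idist (proj T x + EuclideanSpace.single v a) (proj T z + EuclideanSpace.single v b)
        ≤ √(dist x y ^ 2 + (a - g) ^ 2) + √(L ^ 2 + (g - b) ^ 2) := by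
      intro g hg
      refine (idist_triangle ?_ ?_ ?_).trans (add_le_add (hstep a g ha hg) (ih g b hg hb))
      · exact add_single_mem_carrier hT (proj_mem_carrier hxy.left_mem T) (supp_proj_subset T x) ha
      · exact add_single_mem_carrier hT (proj_mem_carrier hxy.right_mem T) (supp_proj_subset T y) hg
      · exact add_single_mem_carrier hT (proj_mem_carrier hyz.symm.left_mem T)
          (supp_proj_subset T z) hb
    have hL : 0 ≤ L := dist_nonneg.trans hyz.dist_le
    rcases (add_nonneg (dist_nonneg (x := x) (y := y)) hL).lt_or_eq with h0 | h0
    · rw [← sqrt_add_sqrt_eq dist_nonneg hL h0]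
      exact htri _ (by positivity)
    · have h1 : dist x y = 0 := by linarith [dist_nonneg (x := x) (y := y)]
      have h2 : L = 0 := by linarith [dist_nonneg (x := x) (y := y)]
      refine (htri b hb).trans ?_
      rw [h1, h2]
      simp

theorem idist_sq_add_le_of_chain (hvT : v ∉ T) {x y : EuclideanSpace ℝ (Fin M)} {L : ℝ}
    (h : X.Chain x y L) : X.idist (proj T x) (proj T y) ^ 2 + (x v - y v) ^ 2 ≤ L ^ 2 := by
  induction h with
  | nil x hx => rw [(adj_self (proj_mem_carrier hx T)).idist_eq]; simp
  | cons x y z L hxy hyz ih =>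
    have hL : 0 ≤ L := dist_nonneg.trans hyz.dist_le
    have h1 : dist (proj T x) (proj T y) ^ 2 + (x v - y v) ^ 2 ≤ dist x y ^ 2 := by
      rw [EuclideanSpace.dist_eq, EuclideanSpace.dist_eq, Real.sq_sqrt (by positivity),
        Real.sq_sqrt (by positivity), ← Finset.add_sum_erase _ _ (Finset.mem_univ v),
        ← Finset.add_sum_erase (a := v) _ (fun i => dist (x i) (y i) ^ 2) (Finset.mem_univ v)]
      have : ∀ i ∈ Finset.univ.erase v, dist (proj T x i) (proj T y i) ^ 2
          ≤ dist (x i) (y i) ^ 2 := fun i _ => by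
        by_cases hi : i ∈ T <;> simp [hi]
      have h3 := Finset.sum_le_sum this
      have h4 : dist (proj T x v) (proj T y v) ^ 2 = 0 := by simp [hvT]
      have h5 : dist (x v) (y v) ^ 2 = (x v - y v) ^ 2 := by rw [Real.dist_eq, sq_abs]
      linarith
    have htri := idist_triangle (proj_mem_carrier hxy.left_mem T)
      (proj_mem_carrier hxy.right_mem T) (proj_mem_carrier hyz.symm.left_mem T)
    rw [(hxy.proj T).idist_eq] at htri
    set a1 := dist (proj T x) (proj T y)
    set a2 := X.idist (proj T y) (proj T z)
    have h0 : 0 ≤ X.idist (proj T x) (proj T z) := dist_nonneg.trans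
      (dist_le_idist (proj_mem_carrier hxy.left_mem T) (proj_mem_carrier hyz.symm.left_mem T))
    have hcs : a1 * a2 + (x v - y v) * (y v - z v) ≤ dist x y * L := by
      refine (abs_le_of_sq_le_sq' ?_ (mul_nonneg dist_nonneg hL)).2
      calc (a1 * a2 + (x v - y v) * (y v - z v)) ^ 2
          ≤ (a1 ^ 2 + (x v - y v) ^ 2) * (a2 ^ 2 + (y v - z v) ^ 2) := by
            nlinarith [sq_nonneg (a1 * (y v - z v) - a2 * (x v - y v))]
        _ ≤ dist x y ^ 2 * L ^ 2 := by gcongr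
        _ = (dist x y * L) ^ 2 := by ring
    have := pow_le_pow_left₀ h0 htri 2
    nlinarith

/-- The star of `v` is the metric product of `X.sub T` and a half-line. Lifting chains bounds the
distance from above; the Cauchy-Schwarz inequality, applied piece by piece along a chain, bounds it
from below. -/
theorem dist_sq_eq_of_mem_star (hvT : v ∉ T)
    (hT : ∀ F ∈ X.faces, F ⊆ T → insert v F ∈ X.faces) {x y : X.IPoint}
    (hx : x ∈ X.sub (insert v T)) (hy : y ∈ X.sub (insert v T)) :
    dist x y ^ 2 = dist (x.proj T) (y.proj T) ^ 2 + (x.1 v - y.1 v) ^ 2 := by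
  have hdec : ∀ x : X.IPoint, x ∈ X.sub (insert v T) →
      x.1 = proj T x.1 + EuclideanSpace.single v (x.1 v) := by
    intro x hx
    ext i
    by_cases hiv : i = v
    · subst hiv; simp [hvT]
    · by_cases hi : i ∈ T
      · simp [hiv, hi]
      · have : x.1 i = 0 := by
          by_contra h0
          have := hx (mem_supp.2 h0)
          simp [hiv, hi] at this
        simp [hiv, hi, this]
  have hnn : ∀ x : X.IPoint, 0 ≤ x.1 v := fun x => (mem_carrier.1 x.2).1 v
  apply le_antisymm
  · have key : ∀ L, X.Chain (x.proj T).1 (y.proj T).1 L →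
        √(dist x y ^ 2 - (x.1 v - y.1 v) ^ 2) ≤ L := by
      intro L hL
      have hL0 : 0 ≤ L := dist_nonneg.trans hL.dist_le
      have := idist_add_single_le_of_chain hvT hT hL (x.1 v) (y.1 v) (hnn x) (hnn y)
      have e : ∀ x : X.IPoint, proj T (x.proj T).1 = proj T x.1 := fun x =>
        proj_eq_self (supp_proj_subset T x.1)
      rw [e, e, ← hdec x hx, ← hdec y hy, ← IPoint.dist_def] at this
      rw [Real.sqrt_le_left hL0]
      have := (Real.le_sqrt dist_nonneg (by positivity)).1 this
      linarith
    have := le_idist (x.proj T).2 (y.proj T).2 key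
    have h0 : 0 ≤ X.idist (x.proj T).1 (y.proj T).1 := (Real.sqrt_nonneg _).trans this
    rw [Real.sqrt_le_left h0] at this
    rw [IPoint.dist_def (x.proj T)]
    linarith
  · have h : √(dist (x.proj T) (y.proj T) ^ 2 + (x.1 v - y.1 v) ^ 2) ≤ dist x y := by
      refine le_idist x.2 y.2 fun L hL => ?_
      rw [Real.sqrt_le_left (dist_nonneg.trans hL.dist_le)]
      exact idist_sq_add_le_of_chain hvT hL
    rwa [Real.sqrt_le_left dist_nonneg] at h

theorem isCAT0_star (hvT : v ∉ T) (hT : ∀ F ∈ X.faces, F ⊆ T → insert v F ∈ X.faces)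
    (h : IsCAT0 (X.sub T)) : IsCAT0 (X.sub (insert v T)) := by
  refine IsCAT0.of_exists fun p hp q hq t ht => ?_
  obtain ⟨m, hm, hpt⟩ := h.exists_isPt _ (p.proj_mem_sub T) _ (q.proj_mem_sub T) t ht
  have hnn : ∀ x : X.IPoint, 0 ≤ x.1 v := fun x => (mem_carrier.1 x.2).1 v
  have ht1 : 0 ≤ 1 - t := by linarith [ht.2]
  have hh : 0 ≤ (1 - t) * p.1 v + t * q.1 v :=
    add_nonneg (mul_nonneg ht1 (hnn p)) (mul_nonneg ht.1 (hnn q))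
  have hmv : m.1 v = 0 := by
    by_contra h0
    exact hvT (hm (mem_supp.2 h0))
  let n : X.IPoint := ⟨m.1 + EuclideanSpace.single v ((1 - t) * p.1 v + t * q.1 v),
    add_single_mem_carrier hT m.2 hm hh⟩
  have hn : n ∈ X.sub (insert v T) := supp_add_single_subset hm _
  have hnp : n.proj T = m := by
    refine IPoint.ext ?_
    change proj T (m.1 + EuclideanSpace.single v ((1 - t) * p.1 v + t * q.1 v)) = m.1
    conv_rhs => rw [← proj_eq_self hm]
    ext i
    by_cases hi : i ∈ T
    · have : i ≠ v := fun h => hvT (h ▸ hi)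
      simp [hi, this]
    · simp [hi]
  have hnv : n.1 v = (1 - t) * p.1 v + t * q.1 v := by
    change (m.1 + EuclideanSpace.single v ((1 - t) * p.1 v + t * q.1 v)) v = _
    simp [hmv]
  refine ⟨n, hn, fun z hz => ?_⟩
  have := h.cnAt _ (p.proj_mem_sub T) _ (q.proj_mem_sub T) m hm _ (z.proj_mem_sub T) t ht hpt
  unfold CNAt at *
  rw [dist_sq_eq_of_mem_star hvT hT hz hn, dist_sq_eq_of_mem_star hvT hT hz hp,
    dist_sq_eq_of_mem_star hvT hT hz hq, dist_sq_eq_of_mem_star hvT hT hp hq, hnp, hnv]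
  linarith

/-- Consider the first piece of the chain on which the `v`-coordinate becomes positive. Its starting
point shares a face with `v`, so its projection to `S` has support in `T` and serves as `c`.
Projecting the part before to `S` and the part after to `insert v S` does not lengthen them. -/
theorem exists_cross_of_chain {S : Finset (Fin M)}
    (hST : ∀ i ∈ S, i ∉ T → ∀ F ∈ X.faces, v ∈ F → i ∉ F) (hTS : T ⊆ S)
    {x y : EuclideanSpace ℝ (Fin M)} {L : ℝ} (h : X.Chain x y L) :
    supp y ⊆ insert v T → x v = 0 →
      ∃ c ∈ X.sub T, X.idist (proj S x) c.1 + X.idist c.1 y ≤ L := by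
  induction h with
  | nil x hx =>
    intro hxT hxv
    have hxT' : supp x ⊆ T := fun i hi => by
      rcases Finset.mem_insert.1 (hxT hi) with rfl | h
      · exact absurd hxv (mem_supp.1 hi)
      · exact h
    refine ⟨⟨x, hx⟩, hxT', ?_⟩
    rw [proj_eq_self (hxT'.trans hTS), (adj_self hx).idist_eq, dist_self, add_zero]
  | cons x y z L hxy hyz ih =>
    intro hz hxv
    by_cases hyv : y v = 0
    · obtain ⟨c, hc, hle⟩ := ih hz hyv
      refine ⟨c, hc, ?_⟩
      have h1 := idist_triangle (proj_mem_carrier hxy.left_mem S)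
        (proj_mem_carrier hxy.right_mem S) c.2
      rw [(hxy.proj S).idist_eq] at h1
      linarith [dist_proj_le S x y]
    · have hc : supp (proj S x) ⊆ T := by
        intro i hi
        rw [supp_proj, Finset.mem_inter] at hi
        by_contra hiT
        exact hST i hi.2 hiT _ hxy.2.2 (Finset.mem_union_right _ (mem_supp.2 hyv))
          (Finset.mem_union_left _ hi.1)
      have hcx := proj_mem_carrier hxy.left_mem S
      refine ⟨⟨proj S x, hcx⟩, hc, ?_⟩
      rw [(adj_self hcx).idist_eq, dist_self, zero_add]
      have e1 : proj S x = proj (insert v S) x := by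
        ext i
        by_cases hiv : i = v
        · subst hiv; simp [hxv]
        · simp [hiv]
      have e2 : proj (insert v S) z = z := proj_eq_self (hz.trans (Finset.insert_subset_insert v hTS))
      change X.idist (proj S x) z ≤ _
      rw [e1]
      conv_lhs => rw [← e2]
      exact (idist_proj_le hxy.left_mem hyz.symm.left_mem _).trans
        (Chain.cons _ _ _ _ hxy hyz).idist_le

/-- Convergence in `ℝ^M` implies convergence in the intrinsic metric. -/
theorem tendsto_dist_of_tendsto_val {u : ℕ → X.IPoint} {c : X.IPoint}
    (h : Tendsto (fun n => (u n).1) atTop (𝓝 c.1)) : Tendsto (fun n => dist (u n) c) atTop (𝓝 0) := by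
  obtain ⟨r, hr, hrc⟩ := exists_radius (mem_carrier.1 c.2).1
  have h1 : Tendsto (fun n => dist (u n).1 c.1) atTop (𝓝 0) := tendsto_iff_dist_tendsto_zero.1 h
  refine h1.congr' ?_
  filter_upwards [h1.eventually_lt_const hr] with n hn
  rw [dist_comm] at hn
  exact (adj_of_supp_subset (mem_carrier.1 c.2).1 (u n).2
    (supp_subset_of_dist_lt hrc hn)).symm.idist_eq.symm

/-- Nearly shortest chains give crossing points that are optimal up to `1 / (n + 1)`. They are
bounded, and a limit point is optimal since Euclidean convergence implies intrinsic convergence. -/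
theorem exists_cross {S : Finset (Fin M)} (hvS : v ∉ S)
    (hST : ∀ i ∈ S, i ∉ T → ∀ F ∈ X.faces, v ∈ F → i ∉ F) (hTS : T ⊆ S) {y z : X.IPoint}
    (hy : y ∈ X.sub S) (hz : z ∈ X.sub (insert v T)) :
    ∃ c ∈ X.sub T, dist y z = dist y c + dist c z := by
  have hyv : y.1 v = 0 := by
    by_contra h0
    exact hvS (hy (mem_supp.2 h0))
  have hex : ∀ n : ℕ, ∃ c ∈ X.sub T, dist y c + dist c z ≤ dist y z + 1 / ((n : ℝ) + 1) := by
    intro n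
    obtain ⟨L, hL, hch⟩ := exists_chain_lt y.2 z.2
      (lt_add_of_pos_right (dist y z) (Nat.one_div_pos_of_nat (n := n)))
    obtain ⟨c, hc, hle⟩ := exists_cross_of_chain hST hTS hch hz hyv
    rw [proj_eq_self hy] at hle
    exact ⟨c, hc, hle.trans hL.le⟩
  choose c hc hle using hex
  have hbd : Bornology.IsBounded (range fun n => (c n).1) := by
    refine (Metric.isBounded_closedBall (x := y.1) (r := dist y z + 1)).subset ?_
    rintro _ ⟨n, rfl⟩
    rw [Metric.mem_closedBall, dist_comm]
    have h1 := IPoint.dist_val_le y (c n)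
    have h2 : 1 / ((n : ℝ) + 1) ≤ 1 := by
      rw [div_le_one (by positivity)]; linarith [n.cast_nonneg (α := ℝ)]
    linarith [hle n, dist_nonneg (x := c n) (y := z)]
  obtain ⟨a, -, φ, hφ, hlim⟩ := tendsto_subseq_of_bounded hbd fun n => mem_range_self n
  have ha : a ∈ X.carrier := isClosed_carrier.mem_of_tendsto hlim
    (Eventually.of_forall fun n => (c (φ n)).2)
  have haT : supp a ⊆ T := by
    intro i hi
    by_contra hiT
    refine mem_supp.1 hi ?_
    have h1 : Tendsto (fun n => (c (φ n)).1 i) atTop (𝓝 (a i)) :=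
      ((EuclideanSpace.proj (𝕜 := ℝ) i).continuous.tendsto a).comp hlim
    refine tendsto_nhds_unique h1 (tendsto_const_nhds.congr fun n => ?_)
    by_contra h0
    exact hiT (hc (φ n) (mem_supp.2 (Ne.symm h0)))
  obtain ⟨a, rfl⟩ : ∃ a' : X.IPoint, a'.1 = a := ⟨⟨a, ha⟩, rfl⟩
  refine ⟨a, haT, le_antisymm (dist_triangle _ _ _) ?_⟩
  have h0 := tendsto_dist_of_tendsto_val (u := fun n => c (φ n)) (c := a) hlim
  have h1 : Tendsto (fun n => dist y z + 1 / ((φ n : ℝ) + 1) + 2 * dist (c (φ n)) a) atTop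
      (𝓝 (dist y z + 0 + 2 * 0)) :=
    (tendsto_const_nhds.add (tendsto_one_div_add_atTop_nhds_zero_nat.comp
      hφ.tendsto_atTop)).add (h0.const_mul 2)
  rw [mul_zero, add_zero, add_zero] at h1
  refine ge_of_tendsto' h1 fun n => ?_
  have := hle (φ n)
  have e1 := dist_triangle y (c (φ n)) a
  have e2 := dist_triangle a (c (φ n)) z
  rw [dist_comm a (c (φ n))] at e2
  linarith

end Star

/-! ### Induction on the vertices -/

theorem isCAT0_sub (S : Finset (Fin M)) : IsCAT0 (X.sub S) := by
  induction S using Finset.induction_on with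
  | empty =>
    have h0 : ∀ x ∈ X.sub ∅, ∀ y ∈ X.sub ∅, x = y := by
      intro x hx y hy
      refine IPoint.ext ?_
      ext i
      have h1 : x.1 i = 0 := by
        by_contra h; exact absurd (hx (mem_supp.2 h)) (Finset.notMem_empty i)
      have h2 : y.1 i = 0 := by
        by_contra h; exact absurd (hy (mem_supp.2 h)) (Finset.notMem_empty i)
      rw [h1, h2]
    refine IsCAT0.of_exists fun p hp q hq t ht => ⟨p, hp, fun z hz => ?_⟩
    unfold CNAt
    rw [h0 z hz p hp, h0 q hq p hp]
    simp
  | insert v S hvS ih =>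
    classical
    by_cases hv : {v} ∈ X.faces
    swap
    · convert ih using 1
      ext x
      refine ⟨fun hx i hi => ?_, fun hx => hx.trans (Finset.subset_insert v S)⟩
      rcases Finset.mem_insert.1 (hx hi) with rfl | h
      · exact absurd (X.down_closed _ (mem_carrier.1 x.2).2 _
          (Finset.singleton_subset_iff.2 hi)) hv
      · exact h
    -- `T` is the vertex set of the link of `v` in the part already built. By the flag condition
    -- every face inside `T` spans a face together with `v`.
    set T := S.filter fun i => ({i, v} : Finset (Fin M)) ∈ X.faces with hTdef
    have hTS : T ⊆ S := Finset.filter_subset _ _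
    have hvT : v ∉ T := fun h => hvS (hTS h)
    have hT : ∀ F ∈ X.faces, F ⊆ T → insert v F ∈ X.faces := by
      intro F hF hFT
      rcases F.eq_empty_or_nonempty with rfl | hne
      · simpa using hv
      have hvF : v ∉ F := fun h => hvT (hFT h)
      refine X.flag _ ?_ ?_
      · rw [Finset.card_insert_of_notMem hvF]
        have := hne.card_pos
        omega
      · intro D hD hcard
        by_cases hvD : v ∈ D
        · obtain ⟨i, hi⟩ : ∃ i, D.erase v = {i} := by
            rw [← Finset.card_eq_one, Finset.card_erase_of_mem hvD, hcard]
          have hiD : i ∈ D.erase v := hi ▸ Finset.mem_singleton_self i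
          have hDe : D = {i, v} := by
            rw [← Finset.insert_erase hvD, hi, Finset.pair_comm]
          have hiF : i ∈ F := (Finset.mem_insert.1 (hD (Finset.mem_of_mem_erase hiD))).resolve_left
            (Finset.ne_of_mem_erase hiD)
          rw [hDe]
          exact (Finset.mem_filter.1 (hFT hiF)).2
        · refine X.down_closed F hF D fun i hi => ?_
          exact (Finset.mem_insert.1 (hD hi)).resolve_left fun h => hvD (h ▸ hi)
    have hST : ∀ i ∈ S, i ∉ T → ∀ F ∈ X.faces, v ∈ F → i ∉ F := by
      intro i hi hiT F hF hvF hiF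
      refine hiT (Finset.mem_filter.2 ⟨hi, X.down_closed F hF _ ?_⟩)
      intro j hj
      rcases Finset.mem_insert.1 hj with rfl | hj
      · exact hiF
      · rw [Finset.mem_singleton.1 hj]; exact hvF
    have hinter : X.sub S ∩ X.sub (insert v T) = X.sub T := by
      ext x
      constructor
      · rintro ⟨h1, h2⟩ i hi
        exact (Finset.mem_insert.1 (h2 hi)).resolve_left fun h => hvS (h ▸ h1 hi)
      · exact fun h => ⟨h.trans hTS, h.trans (Finset.subset_insert v T)⟩
    have hsubT : IsCAT0 (X.sub T) :=
      ⟨fun p hp q hq t ht => exists_isPt_sub ih hTS hp hq ht,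
        fun p hp q hq n hn z hz t ht hpt => ih.cnAt p (hp.trans hTS) q (hq.trans hTS) n
          (hn.trans hTS) z (hz.trans hTS) t ht hpt⟩
    have hglue : Glueable (X.sub S) (X.sub (insert v T)) :=
      { left := ih
        right := isCAT0_star hvT hT hsubT
        convex := by rw [hinter]; exact hsubT.exists_isPt
        cross := by rw [hinter]; exact fun y hy z hz => exists_cross hvS hST hTS hy hz }
    convert hglue.isCAT0_union using 1
    ext x
    constructor
    · intro hx
      by_cases hvx : v ∈ supp x.1
      · refine Or.inr fun i hi => ?_
        rcases Finset.mem_insert.1 (hx hi) with rfl | h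
        · exact Finset.mem_insert_self _ _
        · refine Finset.mem_insert_of_mem ?_
          by_contra hiT
          exact hST i h hiT _ (mem_carrier.1 x.2).2 hvx hi
      · refine Or.inl fun i hi => ?_
        exact (Finset.mem_insert.1 (hx hi)).resolve_left fun h => hvx (h ▸ hi)
    · rintro (hx | hx)
      · exact hx.trans (Finset.subset_insert v S)
      · exact hx.trans (Finset.insert_subset_insert v hTS)

/-- An orthant space is a `CAT(0)` space. -/
theorem isCAT0_univ : IsCAT0 (univ : Set X.IPoint) := by
  convert isCAT0_sub (X := X) Finset.univ using 1
  ext x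
  simp [sub]

end OrthantSpace

/-! ### Geodesics in `CAT(0)` spaces -/

section Geodesics

variable {α : Type*} [MetricSpace α]

theorem IsPt.trans {p q m n : α} {s t : ℝ} (h : IsPt p q t m) (h' : IsPt p m s n) :
    IsPt p q (s * t) n := by
  have h1 := h'.1
  have h2 := h'.2
  rw [h.1] at h1 h2
  refine IsPt.of_le (by linarith) ?_
  have := dist_triangle n m q
  rw [h.2, h2] at this
  linarith

/-- Two comparisons: at `m` seen from `m'`, and at `m'` seen from `q`. -/
theorem IsCAT0.dist_le_mul (h : IsCAT0 (univ : Set α)) {p q q' m m' : α} {t : ℝ}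
    (ht : t ∈ Icc (0 : ℝ) 1) (hm : IsPt p q t m) (hm' : IsPt p q' t m') :
    dist m m' ≤ t * dist q q' := by
  have h1 := h.cnAt p trivial q trivial m trivial m' trivial t ht hm
  have h2 := h.cnAt p trivial q' trivial m' trivial q trivial t ht hm'
  unfold CNAt at h1 h2
  rw [dist_comm m' p, hm'.1, dist_comm m' q, dist_comm m' m] at h1
  rw [dist_comm q p] at h2
  refine (abs_le_of_sq_le_sq' ?_ (mul_nonneg ht.1 dist_nonneg)).2
  nlinarith [mul_le_mul_of_nonneg_left h2 ht.1]

theorem IsCAT0.isPt_unique (h : IsCAT0 (univ : Set α)) {p q m m' : α} {t : ℝ}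
    (ht : t ∈ Icc (0 : ℝ) 1) (hm : IsPt p q t m) (hm' : IsPt p q t m') : m = m' := by
  have := h.dist_le_mul ht hm hm'
  rw [dist_self, mul_zero] at this
  exact dist_le_zero.1 this

theorem IsCAT0.dist_le_mul_right (h : IsCAT0 (univ : Set α)) {p p' q m m' : α} {t : ℝ}
    (ht : t ∈ Icc (0 : ℝ) 1) (hm : IsPt p q t m) (hm' : IsPt p' q t m') :
    dist m m' ≤ dist p p' := by
  have := h.dist_le_mul ⟨by linarith [ht.2], by linarith [ht.1]⟩ hm.symm hm'.symm
  refine this.trans (mul_le_of_le_one_left dist_nonneg (by linarith [ht.1]))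

theorem IsCAT0.dist_eq_abs_mul (h : IsCAT0 (univ : Set α)) {p q m m' : α} {s t : ℝ}
    (hs : s ∈ Icc (0 : ℝ) 1) (hm : IsPt p q s m) (hm' : IsPt p q t m') :
    dist m m' = |s - t| * dist p q := by
  apply le_antisymm
  · have h1 := h.cnAt p trivial q trivial m trivial m' trivial s hs hm
    unfold CNAt at h1
    rw [dist_comm m' p, hm'.1, hm'.2, dist_comm m' m] at h1
    refine (abs_le_of_sq_le_sq' ?_ (mul_nonneg (abs_nonneg _) dist_nonneg)).2
    rw [mul_pow, sq_abs]
    linarith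
  · have h1 := abs_dist_sub_le m m' p
    rw [dist_comm m p, dist_comm m' p, hm.1, hm'.1, ← sub_mul, abs_mul,
      abs_of_nonneg (dist_nonneg (x := p))] at h1
    exact h1

end Geodesics

namespace OrthantSpace

variable {M m : ℕ} {X : OrthantSpace M m}

/-- The point with parameter `t ∈ [0, 1]` on the geodesic from `x` to `y`. -/
noncomputable def IPoint.geo (x y : X.IPoint) (t : ℝ) : X.IPoint :=
  haveI : Nonempty X.IPoint := ⟨x⟩
  Classical.epsilon fun n => IsPt x y t n

theorem IPoint.geo_spec (x y : X.IPoint) {t : ℝ} (ht : t ∈ Icc (0 : ℝ) 1) :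
    IsPt x y t (x.geo y t) :=
  haveI : Nonempty X.IPoint := ⟨x⟩
  Classical.epsilon_spec (p := fun n => IsPt x y t n)
    (let ⟨n, _, hn⟩ := isCAT0_univ.exists_isPt x trivial y trivial t ht; ⟨n, hn⟩)

theorem Adj.isPt {x y z : X.IPoint} (h : X.Adj x.1 y.1) {s : ℝ} (hs : s ∈ Icc (0 : ℝ) 1)
    (hz : z.1 = x.1 + s • (y.1 - x.1)) : IsPt x y s z := by
  have hseg : z.1 ∈ segment ℝ x.1 y.1 := by
    refine ⟨1 - s, s, by linarith [hs.2], hs.1, by ring, ?_⟩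
    rw [hz, smul_sub, sub_smul, one_smul]; abel
  have h1 := h.of_mem_segment (left_mem_segment ℝ _ _) hseg
  have h2 := h.of_mem_segment hseg (right_mem_segment ℝ _ _)
  unfold IsPt
  rw [h1.dist_eq, h2.dist_eq, h.dist_eq, hz, dist_eq_norm, dist_eq_norm, dist_eq_norm]
  constructor
  · rw [sub_add_cancel_left, norm_neg, norm_smul, norm_sub_rev x.1, Real.norm_of_nonneg hs.1]
  · have : x.1 + s • (y.1 - x.1) - y.1 = (1 - s) • (x.1 - y.1) := by
      rw [sub_smul, one_smul, smul_sub, smul_sub]; abel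
    rw [this, norm_smul, Real.norm_of_nonneg (by linarith [hs.2])]

theorem Adj.exists_val_eq {x y : EuclideanSpace ℝ (Fin M)} (h : X.Adj x y) {s : ℝ}
    (hs : s ∈ Icc (0 : ℝ) 1) : ∃ z : X.IPoint, z.1 = x + s • (y - x) := by
  refine ⟨⟨_, h.segment_subset (a := x + s • (y - x)) ⟨1 - s, s, by linarith [hs.2], hs.1, by ring, ?_⟩⟩, rfl⟩
  rw [smul_sub, sub_smul, one_smul]; abel

/-- Near its starting point `x` a geodesic is a straight line. -/
theorem Adj.val_eq {x n z : X.IPoint} (h : X.Adj x.1 n.1) {s : ℝ} (hs : s ∈ Icc (0 : ℝ) 1)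
    (hz : IsPt x n s z) : z.1 = x.1 + s • (n.1 - x.1) := by
  obtain ⟨z', hz'⟩ := h.exists_val_eq hs
  rw [← hz', isCAT0_univ.isPt_unique hs hz (h.isPt hs hz')]

/-- `r` is at most the distance of `x` from the strata not containing the stratum of `x` in their
closures. -/
def IsRadius (x : X.IPoint) (r : ℝ) : Prop := 0 < r ∧ ∀ i ∈ supp x.1, r ≤ x.1 i

theorem exists_isRadius (x : X.IPoint) : ∃ r, IsRadius x r :=
  let ⟨r, h, h'⟩ := exists_radius (mem_carrier.1 x.2).1
  ⟨r, h, h'⟩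

theorem IsRadius.supp_subset {x y : X.IPoint} {r : ℝ} (hr : IsRadius x r) (h : dist x y < r) :
    supp x.1 ⊆ supp y.1 :=
  supp_subset_of_dist_lt hr.2 ((IPoint.dist_val_le x y).trans_lt h)

theorem adj_of_subset {x y : X.IPoint} (h : supp x.1 ⊆ supp y.1) : X.Adj x.1 y.1 :=
  adj_of_supp_subset (mem_carrier.1 x.2).1 y.2 h

theorem IsRadius.adj {x y : X.IPoint} {r : ℝ} (hr : IsRadius x r) (h : dist x y < r) :
    X.Adj x.1 y.1 :=
  adj_of_subset (hr.supp_subset h)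

theorem exists_small {d r : ℝ} (hr : 0 < r) (hd : 0 ≤ d) : ∃ t ∈ Ioc (0 : ℝ) 1, t * d < r := by
  refine ⟨r / (r + d), ⟨by positivity, (div_le_one (by positivity)).2 (by linarith)⟩, ?_⟩
  rw [div_mul_eq_mul_div, div_lt_iff₀ (by positivity)]
  nlinarith

theorem isPt_div {x y n z : X.IPoint} {s t : ℝ} (hs : 0 ≤ s) (hst : s ≤ t) (ht0 : 0 < t)
    (ht : t ≤ 1) (hn : IsPt x y t n) (hz : IsPt x y s z) : IsPt x n (s / t) z := by
  have hst' : s / t ∈ Icc (0 : ℝ) 1 := ⟨div_nonneg hs ht0.le, (div_le_one ht0).2 hst⟩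
  have h1 := hn.trans (x.geo_spec n hst')
  rw [div_mul_cancel₀ _ ht0.ne'] at h1
  rw [isCAT0_univ.isPt_unique ⟨hs, hst.trans ht⟩ hz h1]
  exact x.geo_spec n hst'

/-- The initial direction of the geodesic from `x` to `y`. -/
theorem exists_direction (x y : X.IPoint) : ∃ v, ∀ r, IsRadius x r → ∀ t ∈ Icc (0 : ℝ) 1,
    t * dist x y < r → ∀ n, IsPt x y t n → n.1 = x.1 + t • v := by
  obtain ⟨r₀, hr₀⟩ := exists_isRadius x
  obtain ⟨t₀, ht₀, htr⟩ := exists_small hr₀.1 (dist_nonneg (x := x) (y := y))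
  have hn₀ := x.geo_spec y ⟨ht₀.1.le, ht₀.2⟩
  set n₀ := x.geo y t₀
  have hadj₀ : X.Adj x.1 n₀.1 := hr₀.adj (by rw [hn₀.1]; exact htr)
  refine ⟨t₀⁻¹ • (n₀.1 - x.1), fun r hr t ht htr n hn => ?_⟩
  have hadj : X.Adj x.1 n.1 := hr.adj (by rw [hn.1]; exact htr)
  -- Of the two straight initial pieces, the shorter is contained in the longer, so both have the
  -- velocity fixed at `t₀`.
  rcases le_total t t₀ with hle | hle
  · have := hadj₀.val_eq ⟨div_nonneg ht.1 ht₀.1.le, (div_le_one ht₀.1).2 hle⟩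
      (isPt_div ht.1 hle ht₀.1 ht₀.2 hn₀ hn)
    rw [this, smul_smul, div_eq_mul_inv]
  · have h0 : 0 < t := ht₀.1.trans_le hle
    have := hadj.val_eq ⟨div_nonneg ht₀.1.le ht.1, (div_le_one h0).2 hle⟩
      (isPt_div ht₀.1.le hle h0 ht.2 hn hn₀)
    rw [this, add_sub_cancel_left, smul_smul, smul_smul]
    have : t * t₀⁻¹ * (t₀ / t) = 1 := by
      have := ht₀.1.ne'
      field_simp
    rw [this, one_smul, add_sub_cancel]

theorem IsGeodesic.isPt {x y : X.IPoint} {γ : ℝ → EuclideanSpace ℝ (Fin M)}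
    (h : X.IsGeodesic x.1 y.1 γ) {t : ℝ} (ht : t ∈ Icc (0 : ℝ) 1) :
    IsPt x y t ⟨γ t, h.2.2.1 t ht⟩ := by
  obtain ⟨h0, h1, -, hd⟩ := h
  constructor
  · have := hd 0 (by simp) t ht
    rw [h0, zero_sub, abs_neg, abs_of_nonneg ht.1] at this
    exact this
  · have := hd t ht 1 (by simp)
    rw [h1, abs_sub_comm, abs_of_nonneg (by linarith [ht.2])] at this
    exact this

theorem isGeodesic_geo (x y : X.IPoint) : X.IsGeodesic x.1 y.1 fun t => (x.geo y t).1 := by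
  refine ⟨?_, ?_, fun t _ => (x.geo y t).2, fun s hs t ht => ?_⟩
  · have := (x.geo_spec y (t := 0) (by simp)).1
    rw [zero_mul] at this
    exact congrArg _ (dist_eq_zero.1 this).symm
  · have := (x.geo_spec y (t := 1) (by simp)).2
    rw [sub_self, zero_mul] at this
    exact congrArg _ (dist_eq_zero.1 this)
  · exact isCAT0_univ.dist_eq_abs_mul hs (x.geo_spec y hs) (x.geo_spec y ht)

/-- The initial tangent vector exists and is unique, which pins down the choice made in `logMap`. -/
theorem isInitialTangent_iff {x y : X.IPoint} {v : EuclideanSpace ℝ (Fin M)}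
    (hv : ∀ r, IsRadius x r → ∀ t ∈ Icc (0 : ℝ) 1,
      t * dist x y < r → ∀ n, IsPt x y t n → n.1 = x.1 + t • v) (v' : EuclideanSpace ℝ (Fin M)) :
    X.IsInitialTangent x.1 y.1 v' ↔ v' = v := by
  have key : ∀ γ : ℝ → EuclideanSpace ℝ (Fin M), X.IsGeodesic x.1 y.1 γ →
      HasDerivWithinAt γ v (Ici 0) 0 := by
    intro γ hγ
    obtain ⟨r, hr⟩ := exists_isRadius x
    obtain ⟨t₀, ht₀, htr⟩ := exists_small hr.1 (dist_nonneg (x := x) (y := y))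
    have h1 : HasDerivWithinAt (fun t : ℝ => x.1 + t • v) v (Ici 0) 0 := by
      have := ((hasDerivAt_id (0 : ℝ)).smul_const v).const_add x.1
      rw [one_smul] at this
      exact this.hasDerivWithinAt
    refine h1.congr_of_eventuallyEq ?_ (by simp [hγ.1])
    filter_upwards [Icc_mem_nhdsGE ht₀.1] with t ht
    have ht' : t ∈ Icc (0 : ℝ) 1 := ⟨ht.1, ht.2.trans ht₀.2⟩
    exact hv r hr t ht' ((mul_le_mul_of_nonneg_right ht.2 dist_nonneg).trans_lt htr) _ (hγ.isPt ht')
  constructor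
  · rintro ⟨γ, hγ, hd⟩
    exact (uniqueDiffOn_Ici (0 : ℝ) 0 (by simp)).eq_deriv _ hd (key γ hγ)
  · rintro rfl
    exact ⟨_, isGeodesic_geo x y, key _ (isGeodesic_geo x y)⟩

/-! ### The logarithm map -/

/-- The logarithm map as a function of points of `X`. -/
noncomputable def IPoint.log (x y : X.IPoint) : EuclideanSpace ℝ (Fin M) := X.logMap x.1 y.1

theorem IPoint.val_eq_add_smul_log {x y n : X.IPoint} {r t : ℝ} (hr : IsRadius x r)
    (ht : t ∈ Icc (0 : ℝ) 1) (htr : t * dist x y < r) (hn : IsPt x y t n) :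
    n.1 = x.1 + t • x.log y := by
  obtain ⟨v, hv⟩ := exists_direction x y
  have h1 : X.IsInitialTangent x.1 y.1 (x.log y) :=
    Classical.epsilon_spec (p := fun v => X.IsInitialTangent x.1 y.1 v)
      ⟨v, (isInitialTangent_iff hv v).2 rfl⟩
  rw [(isInitialTangent_iff hv _).1 h1]
  exact hv r hr t ht htr n hn

theorem IPoint.norm_log (x y : X.IPoint) : ‖x.log y‖ = dist x y := by
  obtain ⟨r, hr⟩ := exists_isRadius x
  obtain ⟨t, ht, htr⟩ := exists_small hr.1 (dist_nonneg (x := x) (y := y))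
  have ht' : t ∈ Icc (0 : ℝ) 1 := ⟨ht.1.le, ht.2⟩
  have hn := x.geo_spec y ht'
  have h1 := IPoint.val_eq_add_smul_log hr ht' htr hn
  have h2 : dist x (x.geo y t) = dist x.1 (x.geo y t).1 :=
    (hr.adj (by rw [hn.1]; exact htr)).dist_eq
  rw [hn.1, h1, dist_eq_norm, sub_add_cancel_left, norm_neg, norm_smul,
    Real.norm_of_nonneg ht.1.le] at h2
  exact (mul_left_cancel₀ ht.1.ne' h2).symm

/-- Contracting both geodesics by a small `t` brings their end points to where they are given by the
logarithms; the contraction multiplies the distance by at most `t`. -/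
theorem IPoint.norm_log_sub_log_le (x y y' : X.IPoint) : ‖x.log y - x.log y'‖ ≤ dist y y' := by
  obtain ⟨r, hr⟩ := exists_isRadius x
  obtain ⟨t, ht, htr⟩ := exists_small hr.1
    (add_nonneg (dist_nonneg (x := x) (y := y)) (dist_nonneg (x := x) (y := y')))
  have ht' : t ∈ Icc (0 : ℝ) 1 := ⟨ht.1.le, ht.2⟩
  rw [mul_add] at htr
  have e1 := mul_nonneg ht.1.le (dist_nonneg (x := x) (y := y))
  have e2 := mul_nonneg ht.1.le (dist_nonneg (x := x) (y := y'))
  have h1 := IPoint.val_eq_add_smul_log hr ht' (by linarith) (x.geo_spec y ht')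
  have h2 := IPoint.val_eq_add_smul_log hr ht' (by linarith) (x.geo_spec y' ht')
  have h3 := (IPoint.dist_val_le _ _).trans
    (isCAT0_univ.dist_le_mul ht' (x.geo_spec y ht') (x.geo_spec y' ht'))
  rw [h1, h2, dist_eq_norm, add_sub_add_left_eq_sub, ← smul_sub, norm_smul,
    Real.norm_of_nonneg ht.1.le] at h3
  exact le_of_mul_le_mul_left h3 ht.1

theorem IPoint.log_of_isPt {x y n : X.IPoint} {t : ℝ} (ht : t ∈ Icc (0 : ℝ) 1)
    (hn : IsPt x y t n) : x.log n = t • x.log y := by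
  obtain ⟨r, hr⟩ := exists_isRadius x
  obtain ⟨s, hs, hsr⟩ := exists_small hr.1 (dist_nonneg (x := x) (y := y))
  have hs' : s ∈ Icc (0 : ℝ) 1 := ⟨hs.1.le, hs.2⟩
  have h0 := x.geo_spec n hs'
  have hle : t * dist x y ≤ dist x y := mul_le_of_le_one_left dist_nonneg ht.2
  have h1 := IPoint.val_eq_add_smul_log hr hs' (by
    rw [hn.1]
    exact (mul_le_mul_of_nonneg_left hle hs.1.le).trans_lt hsr) h0
  have h2 := IPoint.val_eq_add_smul_log hr ⟨mul_nonneg hs.1.le ht.1, mul_le_one₀ hs.2 ht.1 ht.2⟩ (by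
    rw [mul_assoc]
    exact (mul_le_mul_of_nonneg_left hle hs.1.le).trans_lt hsr) (hn.trans h0)
  rw [h1, add_right_inj, ← smul_smul] at h2
  exact smul_right_injective _ hs.1.ne' h2

/-- The lower first variation inequality. -/
theorem IPoint.le_dist_sq {x z : X.IPoint} (y : X.IPoint) (hz : supp z.1 ⊆ supp x.1) :
    dist x y ^ 2 - 2 * inner ℝ (x.log y) (z.1 - x.1) + ‖z.1 - x.1‖ ^ 2 ≤ dist z y ^ 2 := by
  obtain ⟨r, hr⟩ := exists_isRadius x
  obtain ⟨t, ht, htr⟩ := exists_small hr.1 (dist_nonneg (x := x) (y := y))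
  have ht' : t ∈ Icc (0 : ℝ) 1 := ⟨ht.1.le, ht.2⟩
  have hn := x.geo_spec y ht'
  set n := x.geo y t
  have hnv := IPoint.val_eq_add_smul_log hr ht' htr hn
  have hxn : supp x.1 ⊆ supp n.1 := hr.supp_subset (by rw [hn.1]; exact htr)
  have h1 := isCAT0_univ.cnAt x trivial y trivial n trivial z trivial t ht' hn
  unfold CNAt at h1
  -- The supports of `z`, `x` and `n` are nested enough for `z` and `n` to lie in one closed
  -- orthant, so their distance is Euclidean. The terms in `t ^ 2` then cancel against the
  -- comparison inequality.
  have hzn : dist z n = ‖(z.1 - x.1) - t • x.log y‖ := by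
    rw [(adj_of_subset (hz.trans hxn)).dist_eq, dist_eq_norm, hnv, sub_sub]
  have hzx : dist z x = ‖z.1 - x.1‖ := by
    rw [(adj_of_subset hz).dist_eq, dist_eq_norm]
  rw [hzn, hzx, norm_sub_sq_real, norm_smul, Real.norm_of_nonneg ht.1.le, IPoint.norm_log,
    inner_smul_right, real_inner_comm] at h1
  refine le_of_mul_le_mul_left ?_ ht.1
  nlinarith

/-- The upper first variation inequality. -/
theorem IPoint.dist_sq_le {x z : X.IPoint} (y : X.IPoint) (hz : supp z.1 ⊆ supp x.1) {r t : ℝ}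
    (hr : IsRadius x r) (ht : t ∈ Ioc (0 : ℝ) 1) (htr : t * dist x y < r) :
    dist z y ^ 2 ≤ dist x y ^ 2 - 2 * inner ℝ (x.log y) (z.1 - x.1) + t⁻¹ * ‖z.1 - x.1‖ ^ 2 := by
  have ht' : t ∈ Icc (0 : ℝ) 1 := ⟨ht.1.le, ht.2⟩
  have hn := x.geo_spec y ht'
  set n := x.geo y t
  have hnv := IPoint.val_eq_add_smul_log hr ht' htr hn
  have hxn : supp x.1 ⊆ supp n.1 := hr.supp_subset (by rw [hn.1]; exact htr)
  have hzn : dist z n = ‖(z.1 - x.1) - t • x.log y‖ := by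
    rw [(adj_of_subset (hz.trans hxn)).dist_eq, dist_eq_norm, hnv, sub_sub]
  have h1 := dist_triangle z n y
  rw [hn.2] at h1
  have h2 := pow_le_pow_left₀ dist_nonneg h1 2
  have h3 : dist z n ^ 2 = ‖z.1 - x.1‖ ^ 2 - 2 * (t * inner ℝ (x.log y) (z.1 - x.1))
      + (t * dist x y) ^ 2 := by
    rw [hzn, norm_sub_sq_real, norm_smul, Real.norm_of_nonneg ht.1.le, IPoint.norm_log,
      inner_smul_right, real_inner_comm]
  -- Convexity of the square, with `dist z n + (1 - t) * dist x y` read as the mean of `dist z n /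
  -- t` and `dist x y`.
  have h4 : t * (dist z n + (1 - t) * dist x y) ^ 2
      ≤ dist z n ^ 2 + t * (1 - t) * dist x y ^ 2 := by
    nlinarith [mul_nonneg (by linarith [ht.2] : 0 ≤ 1 - t) (sq_nonneg (dist z n - t * dist x y))]
  refine le_of_mul_le_mul_left ?_ ht.1
  have h5 := mul_le_mul_of_nonneg_left h2 ht.1.le
  have h6 : t * (dist x y ^ 2 - 2 * inner ℝ (x.log y) (z.1 - x.1) + t⁻¹ * ‖z.1 - x.1‖ ^ 2)
      = t * dist x y ^ 2 - 2 * (t * inner ℝ (x.log y) (z.1 - x.1)) + ‖z.1 - x.1‖ ^ 2 := by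
    have := ht.1.ne'
    field_simp
  rw [h6]
  nlinarith

/-! ### Local dilations -/

theorem expand_nonneg {x p : EuclideanSpace ℝ (Fin M)} {r κ : ℝ}
    (hr : ∀ i ∈ supp x, r ≤ x i) (hκ : 0 < κ) (hp : ∀ i, 0 ≤ p i)
    (h : dist x p < κ * r) (i : Fin M) : 0 ≤ (x + κ⁻¹ • (p - x)) i := by
  simp only [PiLp.add_apply, PiLp.smul_apply, PiLp.sub_apply, smul_eq_mul]
  by_cases hi : i ∈ supp x
  · have h1 := (abs_sub_apply_le x p i).trans_lt h
    have h2 := hr i hi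
    have h3 : κ⁻¹ * |x i - p i| < r := by
      rw [inv_mul_lt_iff₀ hκ]; exact h1
    have h4 : κ⁻¹ * (x i - p i) ≤ κ⁻¹ * |x i - p i| :=
      mul_le_mul_of_nonneg_left (le_abs_self _) (inv_nonneg.2 hκ.le)
    have : κ⁻¹ * (p i - x i) = - (κ⁻¹ * (x i - p i)) := by ring
    linarith
  · have : x i = 0 := by simpa using hi
    rw [this, sub_zero, zero_add]
    exact mul_nonneg (inv_nonneg.2 hκ.le) (hp i)

theorem supp_expand_subset {x p : EuclideanSpace ℝ (Fin M)} (κ : ℝ) (h : supp x ⊆ supp p) :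
    supp (x + κ • (p - x)) ⊆ supp p := by
  intro i hi
  rw [mem_supp] at hi ⊢
  intro h0
  have h1 : x i = 0 := by
    by_contra h1
    exact mem_supp.1 (h (mem_supp.2 h1)) h0
  exact hi (by simp [h0, h1])

theorem Adj.expand {x p q : EuclideanSpace ℝ (Fin M)} {r κ : ℝ}
    (hr0 : 0 < r) (hr : ∀ i ∈ supp x, r ≤ x i) (hκ : κ ∈ Ioc (0 : ℝ) 1) (h : X.Adj p q)
    (hp : dist x p < κ * r) (hq : dist x q < κ * r) :
    X.Adj (x + κ⁻¹ • (p - x)) (x + κ⁻¹ • (q - x)) := by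
  have hκr : κ * r ≤ r := mul_le_of_le_one_left hr0.le hκ.2
  refine ⟨expand_nonneg hr hκ.1 h.1 hp, expand_nonneg hr hκ.1 h.2.1 hq,
    X.down_closed _ h.2.2 _ ?_⟩
  exact Finset.union_subset_union
    (supp_expand_subset _ (supp_subset_of_dist_lt hr (hp.trans_le hκr)))
    (supp_expand_subset _ (supp_subset_of_dist_lt hr (hq.trans_le hκr)))

/-- A chain that stays within `κ * r` of `x` can be expanded by `κ⁻¹`: coordinates in the support of
`x` stay non-negative, and no support grows. -/
theorem Chain.expand {x p q : EuclideanSpace ℝ (Fin M)} {r κ L : ℝ}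
    (hr0 : 0 < r) (hr : ∀ i ∈ supp x, r ≤ x i) (hκ : κ ∈ Ioc (0 : ℝ) 1) (h : X.Chain p q L) :
    dist x p + L < κ * r → X.Chain (x + κ⁻¹ • (p - x)) (x + κ⁻¹ • (q - x)) (κ⁻¹ * L) := by
  induction h with
  | nil p hp =>
    intro h
    rw [add_zero] at h
    rw [mul_zero]
    exact Chain.nil _ ((adj_self hp).expand hr0 hr hκ h h).left_mem
  | cons p p' q L hpp hL ih =>
    intro h
    have h1 := dist_triangle x p p'
    have hL0 : 0 ≤ L := dist_nonneg.trans hL.dist_le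
    have h2 : dist (x + κ⁻¹ • (p - x)) (x + κ⁻¹ • (p' - x)) = κ⁻¹ * dist p p' := by
      rw [dist_add_left, dist_smul₀, dist_sub_right, Real.norm_of_nonneg (inv_nonneg.2 hκ.1.le)]
    rw [mul_add, ← h2]
    refine Chain.cons _ _ _ _ (hpp.expand hr0 hr hκ ?_ ?_) (ih (by linarith))
    · linarith [dist_nonneg (x := p) (y := p')]
    · linarith

/-- Near `x` the dilations with centre `x` scale the intrinsic metric. -/
theorem IsRadius.dist_dilate {x y y' n n' : X.IPoint} {r κ : ℝ} (hr : IsRadius x r)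
    (hκ : κ ∈ Ioc (0 : ℝ) 1) (hy : dist x y < r / 3) (hy' : dist x y' < r / 3)
    (hn : IsPt x y κ n) (hn' : IsPt x y' κ n') : dist n n' = κ * dist y y' := by
  have hκ' : κ ∈ Icc (0 : ℝ) 1 := ⟨hκ.1.le, hκ.2⟩
  refine le_antisymm (isCAT0_univ.dist_le_mul hκ' hn hn') ?_
  by_contra! hlt
  obtain ⟨L, hL, hch⟩ := exists_chain_lt n.2 n'.2 hlt
  have hr3 : r / 3 ≤ r := by linarith [hr.1]
  have hxn : dist x.1 n.1 ≤ κ * dist x y := hn.1 ▸ IPoint.dist_val_le x n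
  have htri : dist y y' ≤ dist x y + dist x y' := dist_triangle_left y y' x
  -- The factor `1 / 3` is used here: `dist x y` enters twice and `dist x y'` once. A shortcut from
  -- `n` to `n'` would expand to one from `y` to `y'`.
  have hlt' : dist x.1 n.1 + L < κ * r := by
    have h1 : κ * dist x y + κ * dist y y' < κ * r := by
      rw [← mul_add]; exact mul_lt_mul_of_pos_left (by linarith) hκ.1
    linarith
  have := (hch.expand hr.1 hr.2 hκ hlt').idist_le
  rw [(hr.adj (hy.trans_le hr3)).val_eq hκ' hn, (hr.adj (hy'.trans_le hr3)).val_eq hκ' hn',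
    add_sub_cancel_left, add_sub_cancel_left, smul_smul, smul_smul, inv_mul_cancel₀ hκ.1.ne',
    one_smul, one_smul, add_sub_cancel, add_sub_cancel] at this
  have h2 : dist y y' ≤ κ⁻¹ * L := this
  rw [le_inv_mul_iff₀ hκ.1] at h2
  linarith

theorem IsRadius.log_dilate {x a b a' b' : X.IPoint} {r κ : ℝ} (hr : IsRadius x r)
    (hκ : κ ∈ Ioc (0 : ℝ) 1) (hab : dist x a + dist a b < r / 3)
    (ha' : IsPt x a κ a') (hb' : IsPt x b κ b') : a'.log b' = κ • a.log b := by
  have hκ' : κ ∈ Icc (0 : ℝ) 1 := ⟨hκ.1.le, hκ.2⟩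
  have ha : dist x a < r / 3 := by linarith [dist_nonneg (x := a) (y := b)]
  have hb : dist x b < r / 3 := (dist_triangle x a b).trans_lt hab
  obtain ⟨r₁, hr₁⟩ := exists_isRadius a
  obtain ⟨r₂, hr₂⟩ := exists_isRadius a'
  obtain ⟨s, hs, hsr⟩ := exists_small (lt_min hr₁.1 hr₂.1)
    (add_nonneg (dist_nonneg (x := a) (y := b)) (dist_nonneg (x := a') (y := b')))
  have hs' : s ∈ Icc (0 : ℝ) 1 := ⟨hs.1.le, hs.2⟩
  rw [mul_add, lt_min_iff] at hsr
  have e1 := mul_nonneg hs.1.le (dist_nonneg (x := a) (y := b))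
  have e2 := mul_nonneg hs.1.le (dist_nonneg (x := a') (y := b'))
  have hn := a.geo_spec b hs'
  set n := a.geo b s
  have hxn : dist x n < r / 3 := by
    have h1 := dist_triangle x a n
    rw [hn.1] at h1
    have := mul_le_of_le_one_left (dist_nonneg (x := a) (y := b)) hs.2
    linarith
  have hn' := x.geo_spec n hκ'
  set n' := x.geo n κ
  have hpt : IsPt a' b' s n' := by
    unfold IsPt
    rw [hr.dist_dilate hκ ha hxn ha' hn', hr.dist_dilate hκ hxn hb hn' hb',
      hr.dist_dilate hκ ha hb ha' hb', hn.1, hn.2]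
    constructor <;> ring
  have h1 := IPoint.val_eq_add_smul_log hr₁ hs' (by linarith) hn
  have h2 := IPoint.val_eq_add_smul_log hr₂ hs' (by linarith) hpt
  have hr3 : r / 3 ≤ r := by linarith [hr.1]
  rw [(hr.adj (ha.trans_le hr3)).val_eq hκ' ha', (hr.adj (hxn.trans_le hr3)).val_eq hκ' hn', h1] at h2
  have h3 : s • (a'.log b') = s • (κ • a.log b) := by
    have : s • (a'.log b') = κ • (a.1 + s • a.log b - x.1) - κ • (a.1 - x.1) := by
      rw [eq_sub_iff_add_eq', ← add_right_inj x.1, ← add_assoc]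
      exact h2.symm
    rw [this, ← smul_sub, smul_comm s κ]
    congr 1
    abel
  exact smul_right_injective _ hs.1.ne' h3

/-- The logarithms at two points near `x`, in the same direction from `x`. -/
theorem IsRadius.norm_log_sub_log_le {x a a' : X.IPoint} (y : X.IPoint) {r κ τ : ℝ}
    (hr : IsRadius x r) (hκ : κ ∈ Ioc (0 : ℝ) 1) (hτ : τ ∈ Ioc (0 : ℝ) 1)
    (ha : dist x a + τ * dist a y < r / 3) (ha' : IsPt x a κ a') :
    ‖a.log y - a'.log y‖ ≤ 2 * dist x a / τ := by
  have hκ' : κ ∈ Icc (0 : ℝ) 1 := ⟨hκ.1.le, hκ.2⟩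
  have hτ' : τ ∈ Icc (0 : ℝ) 1 := ⟨hτ.1.le, hτ.2⟩
  have hκτ : κ * τ ∈ Icc (0 : ℝ) 1 := ⟨mul_nonneg hκ'.1 hτ'.1, mul_le_one₀ hκ'.2 hτ'.1 hτ'.2⟩
  have hp := a.geo_spec y hτ'
  have hp' := x.geo_spec (a.geo y τ) hκ'
  have hq := a'.geo_spec y hκτ
  have hR := x.geo_spec y hτ'
  have hR' := x.geo_spec (x.geo y τ) hκ'
  set p := a.geo y τ
  set p' := x.geo p κ
  set q := a'.geo y (κ * τ)
  set R := x.geo y τ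
  set R' := x.geo R κ
  -- Both `p'` and `q` are within `κ * dist x a` of `R'`, the point with parameter `κ * τ` between
  -- `x` and `y`. As their logarithms at `a'` are `κ * τ` times the two vectors to be compared, `κ`
  -- cancels and the bound does not depend on it.
  have h1 : a'.log p' = (κ * τ) • a.log y := by
    rw [hr.log_dilate hκ (by rw [hp.1]; exact ha) ha' hp', IPoint.log_of_isPt hτ' hp, smul_smul]
  have h2 : a'.log q = (κ * τ) • a'.log y := IPoint.log_of_isPt hκτ hq
  have h3 := a'.norm_log_sub_log_le p' q
  rw [h1, h2, ← smul_sub, norm_smul, Real.norm_of_nonneg hκτ.1] at h3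
  have h4 : dist p' R' ≤ κ * dist x a := by
    refine (isCAT0_univ.dist_le_mul hκ' hp' hR').trans (mul_le_mul_of_nonneg_left ?_ hκ'.1)
    rw [dist_comm x a]
    exact isCAT0_univ.dist_le_mul_right hτ' hp hR
  have h5 : dist R' q ≤ κ * dist x a := by
    rw [← ha'.1]
    exact isCAT0_univ.dist_le_mul_right hκτ (hR.trans hR') hq
  have h6 := dist_triangle p' R' q
  rw [le_div_iff₀ hτ.1]
  refine le_of_mul_le_mul_left ?_ hκ.1
  nlinarith

end OrthantSpace

namespace OrthantSpace

variable {M m : ℕ} {X : OrthantSpace M m}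

/-! ### Directional limits of the logarithm map -/

theorem supp_add_subset {x w : EuclideanSpace ℝ (Fin M)} {T : Finset (Fin M)} (hx : supp x ⊆ T)
    (hw : supp w ⊆ T) (c : ℝ) : supp (x + c • w) ⊆ T := by
  intro i hi
  by_contra hiT
  have h1 : x i = 0 := by
    by_contra h; exact hiT (hx (mem_supp.2 h))
  have h2 : w i = 0 := by
    by_contra h; exact hiT (hw (mem_supp.2 h))
  exact mem_supp.1 hi (by simp [h1, h2])

theorem add_smul_mem_orthant {T E : Finset (Fin M)} {x w : EuclideanSpace ℝ (Fin M)}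
    (hx : x ∈ orthant E) (hw : w ∈ orthant (T \ E)) (hET : E ⊆ T) {c : ℝ} (hc : 0 < c) :
    x + c • w ∈ orthant T := by
  constructor
  · intro i hi
    simp only [PiLp.add_apply, PiLp.smul_apply, smul_eq_mul]
    by_cases hiE : i ∈ E
    · have := mul_nonneg hc.le (nonneg_of_mem_orthant hw i)
      have := hx.1 i hiE
      linarith
    · rw [hx.2 i hiE, zero_add]
      exact mul_pos hc (hw.1 i (Finset.mem_sdiff.2 ⟨hi, hiE⟩))
  · intro i hi
    have h1 := hx.2 i fun h => hi (hET h)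
    have h2 := hw.2 i fun h => hi (Finset.mem_sdiff.1 h).1
    simp [h1, h2]

theorem mem_carrier_of_mem_orthant {T : Finset (Fin M)} (hT : T ∈ X.faces)
    {x : EuclideanSpace ℝ (Fin M)} (hx : x ∈ orthant T) : x ∈ X.carrier :=
  mem_carrier.2 ⟨nonneg_of_mem_orthant hx, (supp_eq_of_mem_orthant hx).symm ▸ hT⟩

section Ray

variable {x : X.IPoint} {a : ℝ → X.IPoint} {w : EuclideanSpace ℝ (Fin M)}

/-- `a` parametrises, for positive arguments, a straight line that starts at `x` with direction
`w` and runs in a stratum whose closure contains `x`. -/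
structure IsRay (x : X.IPoint) (w : EuclideanSpace ℝ (Fin M)) (T : Finset (Fin M))
    (a : ℝ → X.IPoint) : Prop where
  val_eq : ∀ l > 0, (a l).1 = x.1 + l • w
  supp_eq : ∀ l > 0, supp (a l).1 = T
  subset : supp x.1 ⊆ T

variable {T : Finset (Fin M)}

theorem IsRay.adj (h : IsRay x w T a) {l : ℝ} (hl : 0 < l) : X.Adj x.1 (a l).1 :=
  adj_of_subset (by rw [h.supp_eq l hl]; exact h.subset)

theorem IsRay.dist_eq (h : IsRay x w T a) {l : ℝ} (hl : 0 < l) : dist x (a l) = l * ‖w‖ := by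
  rw [(h.adj hl).dist_eq, h.val_eq l hl, dist_eq_norm, sub_add_cancel_left, norm_neg, norm_smul,
    Real.norm_of_nonneg hl.le]

theorem IsRay.isPt (h : IsRay x w T a) {k l : ℝ} (hk : 0 < k) (hkl : k ≤ l) :
    IsPt x (a l) (k / l) (a k) := by
  have hl := hk.trans_le hkl
  refine (h.adj hl).isPt ⟨by positivity, (div_le_one hl).2 hkl⟩ ?_
  rw [h.val_eq l hl, h.val_eq k hk, add_sub_cancel_left, smul_smul, div_mul_cancel₀ _ hl.ne']

theorem IsRay.tendsto_val (h : IsRay x w T a) :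
    Tendsto (fun l => (a l).1) (𝓝[>] 0) (𝓝 x.1) := by
  have : Tendsto (fun l : ℝ => x.1 + l • w) (𝓝[>] 0) (𝓝 x.1) := by
    have hc : ContinuousAt (fun l : ℝ => x.1 + l • w) 0 := by fun_prop
    have := hc.tendsto
    rw [zero_smul, add_zero] at this
    exact this.mono_left nhdsWithin_le_nhds
  refine this.congr' ?_
  filter_upwards [self_mem_nhdsWithin] with l hl
  exact (h.val_eq l hl).symm

theorem IsRay.tendsto_dist (h : IsRay x w T a) : Tendsto (fun l => dist x (a l)) (𝓝[>] 0) (𝓝 0) := by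
  have : Tendsto (fun l : ℝ => l * ‖w‖) (𝓝[>] 0) (𝓝 0) := by
    have hc : ContinuousAt (fun l : ℝ => l * ‖w‖) 0 := by fun_prop
    have := hc.tendsto
    rw [zero_mul] at this
    exact this.mono_left nhdsWithin_le_nhds
  refine this.congr' ?_
  filter_upwards [self_mem_nhdsWithin] with l hl
  exact (h.dist_eq hl).symm

theorem IsRay.tendsto_dist_right (h : IsRay x w T a) (y : X.IPoint) :
    Tendsto (fun l => dist (a l) y) (𝓝[>] 0) (𝓝 (dist x y)) := by
  rw [tendsto_iff_dist_tendsto_zero]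
  refine squeeze_zero (fun _ => dist_nonneg) (fun l => ?_) h.tendsto_dist
  rw [dist_comm x (a l)]
  exact abs_dist_sub_le _ _ _

/-- Points of a ray are dilates of each other about `x`, so with `τ` fixed the bound `2 * dist x (a
l) / τ` makes the logarithms Cauchy. -/
theorem IsRay.exists_tendsto_log (h : IsRay x w T a) (y : X.IPoint) :
    ∃ v, Tendsto (fun l => (a l).log y) (𝓝[>] 0) (𝓝 v) := by
  rw [← cauchy_map_iff_exists_tendsto, Metric.cauchy_iff]
  refine ⟨inferInstance, fun ε hε => ?_⟩
  obtain ⟨r, hr⟩ := exists_isRadius x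
  have hr6 : 0 < r / 6 := by linarith [hr.1]
  obtain ⟨τ, hτ, hτr⟩ := exists_small hr6 (by positivity : 0 ≤ dist x y + 1)
  have hev : ∀ᶠ l in 𝓝[>] (0 : ℝ), dist x (a l) < r / 6 ∧ dist (a l) y < dist x y + 1 ∧
      2 * dist x (a l) / τ < ε := by
    refine (h.tendsto_dist.eventually_lt_const hr6).and
      (((h.tendsto_dist_right y).eventually_lt_const (lt_add_one _)).and ?_)
    have := (h.tendsto_dist.const_mul 2).div_const τ
    rw [mul_zero, zero_div] at this
    exact this.eventually_lt_const hε
  obtain ⟨δ, hδ, hsub⟩ := mem_nhdsGT_iff_exists_Ioo_subset.1 hev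
  have key : ∀ k l, 0 < k → k ≤ l → l < δ → dist ((a l).log y) ((a k).log y) < ε := by
    intro k l hk hkl hl
    obtain ⟨h1, h2, h3⟩ := hsub ⟨hk.trans_le hkl, hl⟩
    rw [dist_eq_norm]
    refine (hr.norm_log_sub_log_le y ⟨div_pos hk (hk.trans_le hkl),
      (div_le_one (hk.trans_le hkl)).2 hkl⟩ hτ ?_ (h.isPt hk hkl)).trans_lt h3
    have := mul_le_mul_of_nonneg_left h2.le hτ.1.le
    linarith
  refine ⟨_, image_mem_map (Ioo_mem_nhdsGT hδ), ?_⟩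
  rintro _ ⟨k, hk, rfl⟩ _ ⟨l, hl, rfl⟩
  rcases le_total k l with hkl | hkl
  · rw [dist_comm]; exact key k l hk.1 hkl hl.2
  · exact key l k hl.1 hkl hk.2

variable {v : EuclideanSpace ℝ (Fin M)} {y : X.IPoint}

theorem IsRay.le_dist_sq (h : IsRay x w T a)
    (hv : Tendsto (fun l => (a l).log y) (𝓝[>] 0) (𝓝 v)) {z : X.IPoint} (hz : supp z.1 ⊆ T) :
    dist x y ^ 2 - 2 * inner ℝ v (z.1 - x.1) + ‖z.1 - x.1‖ ^ 2 ≤ dist z y ^ 2 := by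
  have hval := h.tendsto_val.const_sub z.1
  have ht := (((h.tendsto_dist_right y).pow 2).sub ((hv.inner hval).const_mul 2)).add
    (hval.norm.pow 2)
  refine le_of_tendsto ht ?_
  filter_upwards [self_mem_nhdsWithin] with l hl
  exact IPoint.le_dist_sq y (by rw [h.supp_eq l hl]; exact hz)

/-- Small displacements in the stratum of `x`. -/
theorem exists_displacement (x : X.IPoint) {u : EuclideanSpace ℝ (Fin M)}
    (hu : supp u ⊆ supp x.1) :
    ∃ δ > 0, ∀ s ∈ Ioo (0 : ℝ) δ, ∃ z : X.IPoint, z.1 = x.1 + s • u ∧ supp z.1 ⊆ supp x.1 := by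
  obtain ⟨r, hr⟩ := exists_isRadius x
  refine ⟨r / (‖u‖ + 1), div_pos hr.1 (by positivity), fun s hs => ?_⟩
  have hsupp := supp_add_subset (Finset.Subset.refl (supp x.1)) hu s
  have hs' : s * (‖u‖ + 1) < r := (lt_div_iff₀ (by positivity)).1 hs.2
  refine ⟨⟨x.1 + s • u, mem_carrier.2 ⟨fun i => ?_, X.down_closed _ (mem_carrier.1 x.2).2 _ hsupp⟩⟩,
    rfl, hsupp⟩
  by_cases hi : i ∈ supp x.1
  · have h1 := abs_sub_apply_le (x.1 + s • u) x.1 i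
    rw [dist_eq_norm, add_sub_cancel_left, norm_smul, Real.norm_of_nonneg hs.1.le] at h1
    have h2 := hr.2 i hi
    have h3 := neg_abs_le ((x.1 + s • u) i - x.1 i)
    linarith [hs.1]
  · by_contra! hneg
    exact hi (hsupp (mem_supp.2 hneg.ne))

/-- Along `u` the lower bound with slope `v` and the upper bound with slope `x.log y` hold for the
same function, so their first order terms are ordered. Using `-u` as well turns this into the
equality `IsRay.inner_eq`. -/
theorem IsRay.inner_le (h : IsRay x w T a)
    (hv : Tendsto (fun l => (a l).log y) (𝓝[>] 0) (𝓝 v)) {u : EuclideanSpace ℝ (Fin M)}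
    (hu : supp u ⊆ supp x.1) : inner ℝ (x.log y) u ≤ inner ℝ v u := by
  obtain ⟨δ, hδ, hδ'⟩ := exists_displacement x hu
  obtain ⟨r, hr⟩ := exists_isRadius x
  obtain ⟨t, ht, htr⟩ := exists_small hr.1 (dist_nonneg (x := x) (y := y))
  have h0 : 0 ≤ 2 * (inner ℝ v u - inner ℝ (x.log y) u) := by
    refine nonneg_of_forall_small (K := t⁻¹ * ‖u‖ ^ 2) hδ fun s hs => ?_
    obtain ⟨z, hz, hzs⟩ := hδ' s hs
    have h1 := h.le_dist_sq hv (hzs.trans h.subset)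
    have h2 := IPoint.dist_sq_le y hzs hr ht htr
    rw [hz, add_sub_cancel_left, inner_smul_right, norm_smul, Real.norm_of_nonneg hs.1.le] at h1 h2
    refine nonneg_of_mul_nonneg_right ?_ hs.1
    nlinarith [sq_nonneg (s * ‖u‖)]
  linarith

theorem supp_neg (u : EuclideanSpace ℝ (Fin M)) : supp (-u) = supp u := by
  ext i; simp

theorem IsRay.inner_eq (h : IsRay x w T a)
    (hv : Tendsto (fun l => (a l).log y) (𝓝[>] 0) (𝓝 v)) {u : EuclideanSpace ℝ (Fin M)}
    (hu : supp u ⊆ supp x.1) : inner ℝ v u = inner ℝ (x.log y) u := by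
  have h1 := h.inner_le hv hu
  have h2 := h.inner_le hv (u := -u) (by rwa [supp_neg])
  rw [inner_neg_right, inner_neg_right] at h2
  linarith

end Ray

/-! ### Integration -/

/-- The points of `X` as points of the intrinsic metric space. -/
def toIPoint (x : X.carrier) : X.IPoint := ⟨x.1, x.2⟩

/-- Near a point the intrinsic and Euclidean distances to it agree. This makes intrinsic distances
measurable for the Euclidean Borel structure. -/
theorem continuous_toIPoint : Continuous (toIPoint : X.carrier → X.IPoint) := by
  rw [Metric.continuous_iff]
  intro c ε hε
  obtain ⟨r, hr⟩ := exists_isRadius (toIPoint c)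
  refine ⟨min r ε, lt_min hr.1 hε, fun y hy => ?_⟩
  rw [lt_min_iff, Subtype.dist_eq] at hy
  have hs : supp (toIPoint c).1 ⊆ supp (toIPoint y).1 :=
    supp_subset_of_dist_lt hr.2 (by rw [dist_comm]; exact hy.1)
  rw [(adj_of_subset hs).symm.dist_eq]
  exact hy.2

section Integral

variable {μ : Measure X.carrier}

theorem continuous_dist_toIPoint (z : X.IPoint) :
    Continuous fun x : X.carrier => dist z (toIPoint x) :=
  continuous_const.dist continuous_toIPoint

theorem frechetFunction_eq_lintegral (μ : Measure X.carrier) (z : X.IPoint) : X.frechetFunction μ z.1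
    = (1 / 2) * ∫⁻ x : X.carrier, ENNReal.ofReal (dist z (toIPoint x) ^ 2) ∂μ := rfl

theorem integrable_of_frechetFunction_ne_top {z : X.IPoint} (h : X.frechetFunction μ z.1 ≠ ⊤) :
    Integrable (fun x => dist z (toIPoint x) ^ 2) μ := by
  refine ⟨((continuous_dist_toIPoint z).pow 2).aestronglyMeasurable, ?_⟩
  rw [hasFiniteIntegral_iff_ofReal (Eventually.of_forall fun x => sq_nonneg _)]
  rw [frechetFunction_eq_lintegral] at h
  rw [lt_top_iff_ne_top]
  intro htop
  rw [htop] at h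
  exact h (ENNReal.mul_top (by simp))

/-- Twice the Fréchet function, as a real valued function. -/
noncomputable def energy (μ : Measure X.carrier) (z : X.IPoint) : ℝ :=
  ∫ x, dist z (toIPoint x) ^ 2 ∂μ

theorem frechetFunction_eq_energy {z : X.IPoint}
    (h : Integrable (fun x => dist z (toIPoint x) ^ 2) μ) :
    X.frechetFunction μ z.1 = ENNReal.ofReal (1 / 2 * energy μ z) := by
  rw [frechetFunction_eq_lintegral, ENNReal.ofReal_mul (by norm_num), energy,
    ofReal_integral_eq_lintegral_ofReal h (Eventually.of_forall fun x => sq_nonneg _)]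
  congr 1
  rw [ENNReal.ofReal_div_of_pos two_pos]
  simp

theorem energy_nonneg (μ : Measure X.carrier) (z : X.IPoint) : 0 ≤ energy μ z :=
  integral_nonneg fun _ => sq_nonneg _

variable [IsProbabilityMeasure μ]

theorem integrable_dist_sq {z : X.IPoint} (h : Integrable (fun x => dist z (toIPoint x) ^ 2) μ)
    (y : X.IPoint) : Integrable (fun x => dist y (toIPoint x) ^ 2) μ := by
  refine ((h.const_mul 2).add (integrable_const (2 * dist y z ^ 2))).mono'
    ((continuous_dist_toIPoint y).pow 2).aestronglyMeasurable (Eventually.of_forall fun x => ?_)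
  rw [Real.norm_of_nonneg (sq_nonneg _)]
  have := pow_le_pow_left₀ dist_nonneg (dist_triangle y z (toIPoint x)) 2
  simp only [Pi.add_apply]
  nlinarith [sq_nonneg (dist y z - dist z (toIPoint x))]

theorem integrable_dist {z : X.IPoint} (h : Integrable (fun x => dist z (toIPoint x) ^ 2) μ) :
    Integrable (fun x => dist z (toIPoint x)) μ := by
  refine (h.add (integrable_const 1)).mono' (continuous_dist_toIPoint z).aestronglyMeasurable
    (Eventually.of_forall fun x => ?_)
  rw [Real.norm_of_nonneg dist_nonneg]
  simp only [Pi.add_apply]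
  nlinarith [sq_nonneg (dist z (toIPoint x) - 1)]

/-- A `1`-Lipschitz map on `X` is integrable. -/
theorem integrable_of_norm_sub_le {z : X.IPoint}
    (h : Integrable (fun x => dist z (toIPoint x) ^ 2) μ) {f : X.IPoint → EuclideanSpace ℝ (Fin M)}
    (hf : ∀ y y', ‖f y - f y'‖ ≤ dist y y') : Integrable (fun x => f (toIPoint x)) μ := by
  have hc : Continuous f := by
    refine (LipschitzWith.of_dist_le_mul (K := 1) fun y y' => ?_).continuous
    rw [NNReal.coe_one, one_mul, dist_eq_norm]
    exact hf y y'
  refine ((integrable_dist h).add (integrable_const ‖f z‖)).mono'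
    (hc.comp continuous_toIPoint).aestronglyMeasurable (Eventually.of_forall fun x => ?_)
  have h1 := hf z (toIPoint x)
  have h2 := norm_sub_norm_le (f (toIPoint x)) (f z)
  rw [norm_sub_rev] at h2
  simp only [Pi.add_apply]
  linarith

theorem energy_le_of_isPt {z : X.IPoint} (h : Integrable (fun x => dist z (toIPoint x) ^ 2) μ)
    {p q n : X.IPoint} {t : ℝ} (ht : t ∈ Icc (0 : ℝ) 1) (hn : IsPt p q t n) :
    energy μ n ≤ (1 - t) * energy μ p + t * energy μ q - t * (1 - t) * dist p q ^ 2 := by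
  have hI := integrable_dist_sq h
  have h1 : ∀ x, dist n (toIPoint x) ^ 2 ≤ (1 - t) * dist p (toIPoint x) ^ 2 +
      t * dist q (toIPoint x) ^ 2 - t * (1 - t) * dist p q ^ 2 := fun x => by
    have := isCAT0_univ.cnAt p trivial q trivial n trivial (toIPoint x) trivial t ht hn
    unfold CNAt at this
    rwa [dist_comm (toIPoint x), dist_comm (toIPoint x), dist_comm (toIPoint x)] at this
  have i1 := (hI p).const_mul (1 - t)
  have i2 := (hI q).const_mul t
  have h2 := integral_mono (hI n) ((i1.add i2).sub (integrable_const (t * (1 - t) * dist p q ^ 2))) h1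
  refine h2.trans (le_of_eq ?_)
  rw [integral_sub' (i1.add i2) (integrable_const _), integral_add' i1 i2, integral_const_mul, integral_const_mul, integral_const]
  simp [energy]

/-- The map `f` is left general so that it can be the logarithm at a point or a directional limit of
logarithms. -/
theorem le_energy {z₀ : X.IPoint} (h : Integrable (fun x => dist z₀ (toIPoint x) ^ 2) μ)
    {f : X.IPoint → EuclideanSpace ℝ (Fin M)} (hf : ∀ y y', ‖f y - f y'‖ ≤ dist y y')
    {x z : X.IPoint} {u : EuclideanSpace ℝ (Fin M)} {c : ℝ}
    (hle : ∀ y, dist x y ^ 2 - 2 * inner ℝ (f y) u + c ≤ dist z y ^ 2) :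
    energy μ x - 2 * inner ℝ (∫ y, f (toIPoint y) ∂μ) u + c ≤ energy μ z := by
  have hI := integrable_dist_sq h
  have i1 := integrable_of_norm_sub_le h hf
  have i2 := (i1.inner_const (𝕜 := ℝ) u).const_mul 2
  have h2 := integral_mono (((hI x).sub i2).add (integrable_const c)) (hI z)
    fun y => hle (toIPoint y)
  refine le_trans (le_of_eq ?_) h2
  rw [integral_add' ((hI x).sub i2) (integrable_const _), integral_sub' (hI x) i2, integral_const_mul, integral_const]
  have : ∫ y, inner ℝ (f (toIPoint y)) u ∂μ = inner ℝ (∫ y, f (toIPoint y) ∂μ) u := by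
    rw [real_inner_comm, ← integral_inner i1 u]
    exact integral_congr_ae (Eventually.of_forall fun y => real_inner_comm _ _)
  rw [this]
  simp [energy]

end Integral

end OrthantSpace

/-! ### First order conditions for a minimum of the energy -/

namespace OrthantSpace

variable {M m : ℕ} {X : OrthantSpace M m}

/-- The coordinate projection as a continuous linear map. -/
noncomputable def projCLM (S : Finset (Fin M)) :
    EuclideanSpace ℝ (Fin M) →L[ℝ] EuclideanSpace ℝ (Fin M) :=
  LinearMap.toContinuousLinearMap
    { toFun := proj S
      map_add' := fun x y => by
        ext i; by_cases hi : i ∈ S <;> simp [hi]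
      map_smul' := fun c x => by
        ext i; by_cases hi : i ∈ S <;> simp [hi] }

@[simp]
theorem projCLM_apply (S : Finset (Fin M)) (x : EuclideanSpace ℝ (Fin M)) :
    projCLM S x = proj S x := rfl

theorem inner_proj_right (S : Finset (Fin M)) (x y : EuclideanSpace ℝ (Fin M)) :
    inner ℝ x (proj S y) = inner ℝ (proj S x) (proj S y) := by
  simp only [PiLp.inner_apply]
  refine Finset.sum_congr rfl fun i _ => ?_
  by_cases hi : i ∈ S <;> simp [hi]

theorem inner_proj_of_supp_subset {S : Finset (Fin M)} {x : EuclideanSpace ℝ (Fin M)}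
    (hx : supp x ⊆ S) (y : EuclideanSpace ℝ (Fin M)) : inner ℝ x (proj S y) = inner ℝ x y := by
  rw [inner_proj_right, real_inner_comm, ← inner_proj_right, proj_eq_self hx, real_inner_comm]

theorem inner_eq_zero_of_disjoint {S : Finset (Fin M)} {x y : EuclideanSpace ℝ (Fin M)}
    (hx : supp x ⊆ S) (hy : ∀ i ∈ S, y i = 0) : inner ℝ x y = 0 := by
  rw [PiLp.inner_apply]
  refine Finset.sum_eq_zero fun i _ => ?_
  by_cases hi : i ∈ S
  · simp [hy i hi]
  · have : x i = 0 := by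
      by_contra h; exact hi (hx (mem_supp.2 h))
    simp [this]

section Mean

variable {μ : Measure X.carrier} [IsProbabilityMeasure μ] {x z₀ : X.IPoint}

/-- The mean of the initial tangent vectors at `x`. -/
noncomputable def meanLog (μ : Measure X.carrier) (x : X.IPoint) : EuclideanSpace ℝ (Fin M) :=
  ∫ y, x.log (toIPoint y) ∂μ

theorem integrable_log (h : Integrable (fun x => dist z₀ (toIPoint x) ^ 2) μ) (x : X.IPoint) :
    Integrable (fun y => x.log (toIPoint y)) μ :=
  integrable_of_norm_sub_le h x.norm_log_sub_log_le

theorem energy_le_of_supp_subset (h : Integrable (fun x => dist z₀ (toIPoint x) ^ 2) μ)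
    {z : X.IPoint} (hz : supp z.1 ⊆ supp x.1) {r : ℝ} (hr : IsRadius x r) :
    energy μ z ≤ energy μ x - 2 * inner ℝ (meanLog μ x) (z.1 - x.1)
      + (1 + 2 / r * ∫ y, dist x (toIPoint y) ∂μ) * ‖z.1 - x.1‖ ^ 2 := by
  have hI := integrable_dist_sq h
  set u := z.1 - x.1
  have i1 := integrable_log h x
  have i2 := (i1.inner_const (𝕜 := ℝ) u).const_mul 2
  have i3 : Integrable (fun y => (1 + 2 / r * dist x (toIPoint y)) * ‖u‖ ^ 2) μ :=
    ((integrable_const 1).add ((integrable_dist (hI x)).const_mul _)).mul_const _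
  have h2 := integral_mono (hI z) (((hI x).sub i2).add i3) fun y => by
    obtain ⟨d, hd⟩ : ∃ d, d = dist x (toIPoint y) := ⟨_, rfl⟩
    have hd0 : 0 ≤ d := hd ▸ dist_nonneg
    have hr0 := hr.1
    have hpos : 0 < r + 2 * d := by positivity
    -- The parameter depends on the data point so that `t⁻¹ = 1 + 2 * d / r` is linear in the
    -- distance, hence integrable.
    have := IPoint.dist_sq_le (toIPoint y) hz hr (t := r / (r + 2 * d))
      ⟨by positivity, (div_le_one hpos).2 (by linarith)⟩ (by
        rw [← hd, div_mul_eq_mul_div, div_lt_iff₀ hpos]; nlinarith)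
    refine this.trans (le_of_eq ?_)
    simp only [Pi.add_apply, Pi.sub_apply]
    rw [← hd]
    have hu : z.1 - x.1 = u := rfl
    rw [hu]
    field_simp
  refine h2.trans (le_of_eq ?_)
  rw [integral_add' ((hI x).sub i2) i3, integral_sub' (hI x) i2, integral_const_mul,
    integral_mul_const, integral_add (integrable_const 1) ((integrable_dist (hI x)).const_mul _),
    integral_const_mul, integral_const]
  have : ∫ y, inner ℝ (x.log (toIPoint y)) u ∂μ = inner ℝ (meanLog μ x) u := by
    rw [real_inner_comm, meanLog, ← integral_inner i1 u]
    exact integral_congr_ae (Eventually.of_forall fun y => real_inner_comm _ _)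
  rw [this]
  simp [energy]

/-- The first variation in the stratum of `x` vanishes at a minimum. -/
theorem proj_meanLog_eq_zero (h : Integrable (fun x => dist z₀ (toIPoint x) ^ 2) μ)
    (hmin : ∀ z, energy μ x ≤ energy μ z) : proj (supp x.1) (meanLog μ x) = 0 := by
  obtain ⟨u, hu⟩ : ∃ u, u = proj (supp x.1) (meanLog μ x) := ⟨_, rfl⟩
  have hus : supp u ⊆ supp x.1 := hu ▸ supp_proj_subset _ _
  obtain ⟨δ, hδ, hδ'⟩ := exists_displacement x hus
  obtain ⟨r, hr⟩ := exists_isRadius x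
  have h0 : 0 ≤ -(2 * inner ℝ (meanLog μ x) u) := by
    refine nonneg_of_forall_small
      (K := (1 + 2 / r * ∫ y, dist x (toIPoint y) ∂μ) * ‖u‖ ^ 2) hδ fun s hs => ?_
    obtain ⟨z, hz, hzs⟩ := hδ' s hs
    have h1 := energy_le_of_supp_subset h hzs hr
    have h2 := hmin z
    rw [hz, add_sub_cancel_left, inner_smul_right, norm_smul, Real.norm_of_nonneg hs.1.le] at h1
    refine nonneg_of_mul_nonneg_right ?_ hs.1
    nlinarith
  rw [hu, inner_proj_right, real_inner_self_eq_norm_sq] at h0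
  rw [← norm_eq_zero]
  nlinarith [sq_nonneg ‖proj (supp x.1) (meanLog μ x)‖]

section Ray

variable {w : EuclideanSpace ℝ (Fin M)} {T : Finset (Fin M)} {a : ℝ → X.IPoint}
  {f : X.IPoint → EuclideanSpace ℝ (Fin M)}

theorem norm_sub_le_of_tendsto_log
    (hf : ∀ y, Tendsto (fun l => (a l).log y) (𝓝[>] 0) (𝓝 (f y))) (y y' : X.IPoint) :
    ‖f y - f y'‖ ≤ dist y y' :=
  le_of_tendsto ((hf y).sub (hf y')).norm (Eventually.of_forall fun l =>
    (a l).norm_log_sub_log_le y y')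

theorem IsRay.tendsto_meanLog (hray : IsRay x w T a)
    (h : Integrable (fun x => dist z₀ (toIPoint x) ^ 2) μ)
    (hf : ∀ y, Tendsto (fun l => (a l).log y) (𝓝[>] 0) (𝓝 (f y))) :
    Tendsto (fun l => meanLog μ (a l)) (𝓝[>] 0) (𝓝 (∫ y, f (toIPoint y) ∂μ)) := by
  refine tendsto_integral_filter_of_dominated_convergence (fun y => 1 + dist x (toIPoint y))
    (Eventually.of_forall fun l => (integrable_log h (a l)).aestronglyMeasurable) ?_
    ((integrable_const 1).add (integrable_dist (integrable_dist_sq h x)))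
    (Eventually.of_forall fun y => hf (toIPoint y))
  filter_upwards [hray.tendsto_dist.eventually_lt_const one_pos] with l hl
  refine Eventually.of_forall fun y => ?_
  rw [IPoint.norm_log]
  have := dist_triangle (a l) x (toIPoint y)
  rw [dist_comm (a l) x] at this
  linarith

/-- The first variation in the direction of a co-bounding stratum is non-negative at a minimum. -/
theorem IsRay.inner_nonpos (hray : IsRay x w T a)
    (h : Integrable (fun x => dist z₀ (toIPoint x) ^ 2) μ)
    (hf : ∀ y, Tendsto (fun l => (a l).log y) (𝓝[>] 0) (𝓝 (f y)))
    (hmin : ∀ z, energy μ x ≤ energy μ z) : inner ℝ w (∫ y, f (toIPoint y) ∂μ) ≤ 0 := by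
  refine le_of_tendsto (tendsto_const_nhds.inner (hray.tendsto_meanLog h hf)) ?_
  filter_upwards [self_mem_nhdsWithin] with l (hl : 0 < l)
  -- The lower bound is applied at `a l` and looks back at the minimum `x`. It already gives `⟨w,
  -- meanLog μ (a l)⟩ ≤ 0` for each `l`, so no derivative at `x` is needed.
  have h1 := le_energy h (a l).norm_log_sub_log_le (x := a l) (z := x) (u := x.1 - (a l).1)
    fun y => IPoint.le_dist_sq y (by rw [hray.supp_eq l hl]; exact hray.subset)
  have h2 := hmin (a l)
  rw [hray.val_eq l hl, sub_add_cancel_left, inner_neg_right, inner_smul_right,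
    real_inner_comm] at h1
  change _ - 2 * -(l * inner ℝ w (meanLog μ (a l))) + _ ≤ _ at h1
  by_contra! hpos
  nlinarith [mul_pos hl hpos, sq_nonneg ‖-(l • w)‖]

theorem IsRay.inner_integral_eq (hray : IsRay x w T a)
    (h : Integrable (fun x => dist z₀ (toIPoint x) ^ 2) μ)
    (hf : ∀ y, Tendsto (fun l => (a l).log y) (𝓝[>] 0) (𝓝 (f y)))
    {u : EuclideanSpace ℝ (Fin M)} (hu : supp u ⊆ supp x.1) :
    inner ℝ u (∫ y, f (toIPoint y) ∂μ) = inner ℝ u (meanLog μ x) := by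
  rw [meanLog, ← integral_inner (integrable_of_norm_sub_le h (norm_sub_le_of_tendsto_log hf)),
    ← integral_inner (integrable_log h x)]
  refine integral_congr_ae (Eventually.of_forall fun y => ?_)
  have := hray.inner_eq (hf (toIPoint y)) hu
  rwa [real_inner_comm, real_inner_comm u] at this

end Ray

/-- Sufficiency of the first order conditions. -/
theorem energy_lt_of_conditions (h : Integrable (fun x => dist z₀ (toIPoint x) ^ 2) μ)
    (h0 : proj (supp x.1) (meanLog μ x) = 0)
    (hT : ∀ T ∈ X.faces, supp x.1 ⊆ T → T ≠ supp x.1 → ∀ w ∈ unitNormals T (supp x.1),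
      ∃ (a : ℝ → X.IPoint) (f : X.IPoint → EuclideanSpace ℝ (Fin M)), IsRay x w T a ∧
        (∀ y, Tendsto (fun l => (a l).log y) (𝓝[>] 0) (𝓝 (f y))) ∧
        inner ℝ w (∫ y, f (toIPoint y) ∂μ) ≤ 0) {z : X.IPoint} (hz : z ≠ x) :
    energy μ x < energy μ z := by
  have hd : 0 < dist x z := dist_pos.2 hz.symm
  obtain ⟨r, hr⟩ := exists_isRadius x
  obtain ⟨t, ht, htr⟩ := exists_small hr.1 (add_pos hd hd).le
  -- Halving keeps the parameter strictly below `1`, so that the strong convexity term at the end is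
  -- positive.
  have ht2 : t / 2 ∈ Icc (0 : ℝ) 1 := ⟨by linarith [ht.1], by linarith [ht.2]⟩
  have hn := x.geo_spec z ht2
  set n := x.geo z (t / 2)
  have hxn : supp x.1 ⊆ supp n.1 := hr.supp_subset (by rw [hn.1]; nlinarith [ht.1])
  have hu0 : ∀ u, supp u ⊆ supp x.1 → inner ℝ u (meanLog μ x) = 0 := fun u hu => by
    rw [← inner_proj_of_supp_subset hu, h0, inner_zero_right]
  have key : energy μ x ≤ energy μ n := by
    by_cases hTE : supp n.1 = supp x.1
    · have h1 := le_energy h x.norm_log_sub_log_le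
        fun y => IPoint.le_dist_sq y hTE.le
      have hs : supp (n.1 - x.1) ⊆ supp x.1 := by
        have := supp_add_subset hTE.le (Finset.Subset.refl (supp x.1)) (-1)
        rwa [neg_one_smul, ← sub_eq_add_neg] at this
      have h2 := hu0 _ hs
      rw [real_inner_comm] at h2
      change inner ℝ (∫ y, x.log (toIPoint y) ∂μ) _ = 0 at h2
      rw [h2] at h1
      nlinarith [sq_nonneg ‖n.1 - x.1‖]
    -- Split `n - x` into its part `w'` normal to the stratum of `x`, handled by the inequality for
    -- `w' / ‖w'‖`, and a tangential part, on which the mean limiting logarithm agrees with `meanLog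
    -- μ x` and so vanishes.
    · obtain ⟨w', hw'⟩ : ∃ w', w' = proj (supp n.1 \ supp x.1) n.1 := ⟨_, rfl⟩
      have hnn := (mem_carrier.1 n.2).1
      have hworth : w' ∈ orthant (supp n.1 \ supp x.1) := by
        constructor
        · intro i hi
          rw [hw', proj_apply, if_pos hi]
          exact lt_of_le_of_ne (hnn i) (Ne.symm (mem_supp.1 (Finset.mem_sdiff.1 hi).1))
        · intro i hi
          rw [hw', proj_apply, if_neg hi]
      have hne : w' ≠ 0 := by
        obtain ⟨i, hi, hi'⟩ := Finset.exists_of_ssubset (hxn.ssubset_of_ne (Ne.symm hTE))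
        intro h
        have := hworth.1 i (Finset.mem_sdiff.2 ⟨hi, hi'⟩)
        rw [h] at this
        exact lt_irrefl _ this
      have hpos : 0 < ‖w'‖ := norm_pos_iff.2 hne
      obtain ⟨a, f, hray, hf, hle⟩ := hT (supp n.1) (mem_carrier.1 n.2).2 hxn hTE (‖w'‖⁻¹ • w')
        ⟨⟨fun i hi => mul_pos (inv_pos.2 hpos) (hworth.1 i hi), fun i hi => by
          simp [hworth.2 i hi]⟩, by
          rw [norm_smul, norm_inv, norm_norm, inv_mul_cancel₀ hpos.ne']⟩
      have h1 := le_energy h (norm_sub_le_of_tendsto_log hf)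
        fun y => hray.le_dist_sq (hf y) (Finset.Subset.refl (supp n.1))
      have hs : supp (n.1 - x.1 - w') ⊆ supp x.1 := by
        intro i hi
        by_contra hix
        have hx0 : x.1 i = 0 := by simpa using hix
        refine mem_supp.1 hi ?_
        by_cases hin : i ∈ supp n.1
        · simp [hw', hx0, hin]
        · have : n.1 i = 0 := by simpa using hin
          simp [hw', hx0, this]
      have h2 := hray.inner_integral_eq h hf hs
      rw [hu0 _ hs, inner_sub_left, sub_eq_zero, real_inner_comm] at h2
      rw [real_inner_smul_left, inv_mul_le_iff₀ hpos, mul_zero] at hle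
      rw [h2] at h1
      nlinarith [sq_nonneg ‖n.1 - x.1‖]
  have hcn := energy_le_of_isPt h ht2 hn
  have ht0 : 0 < t / 2 := by linarith [ht.1]
  have ht1 : 0 < 1 - t / 2 := by linarith [ht.2]
  have h3 : 0 < t / 2 * (1 - t / 2) * dist x z ^ 2 := by positivity
  by_contra! hcon
  nlinarith

end Mean

/-! ### Translation to the maps `Φ` and `Ψ` -/

theorem integral_projCLM_add {μ : Measure X.carrier} [IsProbabilityMeasure μ] (S : Finset (Fin M))
    {g : X.carrier → EuclideanSpace ℝ (Fin M)} (hg : Integrable g μ)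
    (c : EuclideanSpace ℝ (Fin M)) :
    ∫ y, projCLM S (g y + c) ∂μ = proj S (∫ y, g y ∂μ) + proj S c := by
  have h : Integrable (fun y => g y + c) μ := hg.add (integrable_const c)
  rw [ContinuousLinearMap.integral_comp_comm _ h, integral_add hg (integrable_const c), map_add]
  simp

theorem exists_isRay {E T : Finset (Fin M)} (hT : T ∈ X.faces) (hET : E ⊆ T) {x : X.IPoint}
    (hx : x.1 ∈ orthant E) {w : EuclideanSpace ℝ (Fin M)} (hw : w ∈ unitNormals T E) :
    ∃ a, IsRay x w T a := by
  classical
  have hmem : ∀ l : ℝ, 0 < l → x.1 + l • w ∈ orthant T := fun l hl =>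
    add_smul_mem_orthant hx hw.1 hET hl
  refine ⟨fun l => if hl : 0 < l then ⟨x.1 + l • w, mem_carrier_of_mem_orthant hT (hmem l hl)⟩
    else x, ⟨fun l hl => ?_, fun l hl => ?_, ?_⟩⟩
  · rw [dif_pos hl]
  · rw [dif_pos hl]; exact supp_eq_of_mem_orthant (hmem l hl)
  · rw [supp_eq_of_mem_orthant hx]; exact hET

theorem IsRay.psi_eq {T : Finset (Fin M)} {x y : X.IPoint} {w v : EuclideanSpace ℝ (Fin M)}
    {a : ℝ → X.IPoint} (h : IsRay x w T a)
    (hv : Tendsto (fun l => (a l).log y) (𝓝[>] 0) (𝓝 v)) : X.Psi y.1 w x.1 = v + x.1 := by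
  refine Tendsto.limUnder_eq ((hv.add h.tendsto_val).congr' ?_)
  filter_upwards [self_mem_nhdsWithin] with l hl
  rw [Phi, ← h.val_eq l hl, IPoint.log]

theorem exists_psi {E T : Finset (Fin M)} (hT : T ∈ X.faces) (hET : E ⊆ T) {x : X.IPoint}
    (hx : x.1 ∈ orthant E) {w : EuclideanSpace ℝ (Fin M)} (hw : w ∈ unitNormals T E) :
    ∃ (a : ℝ → X.IPoint) (f : X.IPoint → EuclideanSpace ℝ (Fin M)), IsRay x w T a ∧
      (∀ y, Tendsto (fun l => (a l).log y) (𝓝[>] 0) (𝓝 (f y))) ∧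
      ∀ y : X.carrier, X.PsiProj T y w x.1 = projCLM T (f (toIPoint y) + x.1) := by
  obtain ⟨a, ha⟩ := exists_isRay hT hET hx hw
  choose f hf using ha.exists_tendsto_log
  refine ⟨a, f, ha, hf, fun y => ?_⟩
  rw [PsiProj, projCLM_apply, ← ha.psi_eq (hf (toIPoint y))]
  rfl

theorem codim_lt_iff {E T : Finset (Fin M)} (hT : T ∈ X.faces) (hET : E ⊆ T) :
    X.codim T < X.codim E ↔ T ≠ E := by
  have h1 : T.card ≤ m := X.dim_eq.2 (mem_image_of_mem _ hT)
  unfold codim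
  constructor
  · rintro h rfl
    exact lt_irrefl _ h
  · intro h
    have := Finset.card_lt_card (hET.ssubset_of_ne (Ne.symm h))
    omega

end OrthantSpace

open OrthantSpace in
/-- `xs` lies in the stratum `σ = orthant E`, and `T` runs through the sets of axes of the strata
`τ = orthant T` that co-bound `σ` and have smaller co-dimension. -/
theorem theorem3 {M m : ℕ} (X : OrthantSpace M m)
    (μ : Measure X.carrier) [IsProbabilityMeasure μ]
    (hfin : ∃ z ∈ X.carrier, X.frechetFunction μ z ≠ ⊤)
    (E : Finset (Fin M)) (hE : E ∈ X.faces)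
    (xs : EuclideanSpace ℝ (Fin M)) (hxs : xs ∈ orthant E) :
    -- the integrals in the two conditions exist
    (∀ T ∈ X.faces, E ⊆ T → X.codim T < X.codim E → ∀ w ∈ OrthantSpace.unitNormals T E,
      Integrable (fun x : X.carrier => X.PsiProj T x w xs) μ) ∧
    Integrable (fun x : X.carrier => X.PhiProj E x xs) μ ∧
    -- the characterisation of the Fréchet mean
    (X.IsFrechetMean μ xs ↔
      (∀ T ∈ X.faces, E ⊆ T → X.codim T < X.codim E → ∀ w ∈ OrthantSpace.unitNormals T E,
        inner ℝ w (∫ x : X.carrier, X.PsiProj T x w xs ∂μ) ≤ 0) ∧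
      xs = ∫ x : X.carrier, X.PhiProj E x xs ∂μ) ∧
    -- a Fréchet mean is the only one
    (X.IsFrechetMean μ xs → ∀ z ∈ X.carrier, z ≠ xs →
      X.frechetFunction μ xs < X.frechetFunction μ z) := by
  have hxm : xs ∈ X.carrier := mem_carrier_of_mem_orthant hE hxs
  obtain ⟨x, rfl⟩ : ∃ x : X.IPoint, x.1 = xs := ⟨⟨xs, hxm⟩, rfl⟩
  obtain ⟨z₀, hz₀, hz₀'⟩ := hfin
  have h := integrable_of_frechetFunction_ne_top (z := ⟨z₀, hz₀⟩) hz₀'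
  have hsx : supp x.1 = E := supp_eq_of_mem_orthant hxs
  have hF : ∀ z : X.IPoint, X.frechetFunction μ z.1 = ENNReal.ofReal (1 / 2 * energy μ z) :=
    fun z => frechetFunction_eq_energy (integrable_dist_sq h z)
  have hmean : X.IsFrechetMean μ x.1 ↔ ∀ z, energy μ x ≤ energy μ z := by
    constructor
    · rintro ⟨-, hmin⟩ z
      have := hmin z.1 z.2
      rw [hF, hF, ENNReal.ofReal_le_ofReal_iff (by linarith [energy_nonneg μ z])] at this
      linarith
    · refine fun hmin => ⟨x.2, fun z hz => ?_⟩
      have := hmin ⟨z, hz⟩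
      rw [hF, hF ⟨z, hz⟩]
      exact ENNReal.ofReal_le_ofReal (by linarith)
  have hlogI := integrable_log h x
  have hPhi : ∀ y : X.carrier, X.PhiProj E y x.1 = projCLM E (x.log (toIPoint y) + x.1) :=
    fun y => rfl
  have hproj : proj E x.1 = x.1 := proj_eq_self hsx.le
  have hPsiI : ∀ T ∈ X.faces, E ⊆ T → ∀ w ∈ unitNormals T E,
      ∃ (a : ℝ → X.IPoint) (f : X.IPoint → EuclideanSpace ℝ (Fin M)), IsRay x w T a ∧
      (∀ y, Tendsto (fun l => (a l).log y) (𝓝[>] 0) (𝓝 (f y))) ∧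
      Integrable (fun y : X.carrier => X.PsiProj T y w x.1) μ ∧
      inner ℝ w (∫ y : X.carrier, X.PsiProj T y w x.1 ∂μ)
        = inner ℝ w (∫ y, f (toIPoint y) ∂μ) := by
    intro T hT hET w hw
    obtain ⟨a, f, ha, hf, hpsi⟩ := exists_psi hT hET hxs hw
    have hfI := integrable_of_norm_sub_le h (norm_sub_le_of_tendsto_log hf)
    have hfI' := hfI.add (integrable_const x.1)
    refine ⟨a, f, ha, hf, ?_, ?_⟩
    · simp_rw [hpsi]
      exact (projCLM T).integrable_comp hfI'
    · simp_rw [hpsi]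
      have hwT : supp w ⊆ T \ E := (supp_eq_of_mem_orthant hw.1).le
      have hwT' := hwT.trans Finset.sdiff_subset
      -- As `w` is supported in `T \ E`, the projection to `ℝ(T)` does not change the inner product,
      -- and the translation by the base point contributes nothing.
      rw [integral_projCLM_add T hfI, inner_add_right, inner_proj_of_supp_subset hwT',
        inner_proj_of_supp_subset hwT',
        inner_eq_zero_of_disjoint hwT fun i hi => hxs.2 i (Finset.mem_sdiff.1 hi).2, add_zero]
  have hii : x.1 = ∫ y : X.carrier, X.PhiProj E y x.1 ∂μ ↔ proj (supp x.1) (meanLog μ x) = 0 := by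
    simp_rw [hPhi]
    rw [integral_projCLM_add E hlogI, hproj, hsx, right_eq_add, meanLog]
  have hsuff : ((∀ T ∈ X.faces, E ⊆ T → X.codim T < X.codim E → ∀ w ∈ unitNormals T E,
        inner ℝ w (∫ y : X.carrier, X.PsiProj T y w x.1 ∂μ) ≤ 0) ∧
      x.1 = ∫ y : X.carrier, X.PhiProj E y x.1 ∂μ) → ∀ z, z ≠ x → energy μ x < energy μ z := by
    rintro ⟨h1, h2⟩ z hz
    refine energy_lt_of_conditions h (hii.1 h2) ?_ hz
    rw [hsx]
    intro T hT hET hne w hw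
    obtain ⟨a, f, ha, hf, -, he⟩ := hPsiI T hT hET w hw
    exact ⟨a, f, ha, hf, he ▸ h1 T hT hET ((codim_lt_iff hT hET).2 hne) w hw⟩
  have hnec : X.IsFrechetMean μ x.1 →
      (∀ T ∈ X.faces, E ⊆ T → X.codim T < X.codim E → ∀ w ∈ unitNormals T E,
        inner ℝ w (∫ y : X.carrier, X.PsiProj T y w x.1 ∂μ) ≤ 0) ∧
      x.1 = ∫ y : X.carrier, X.PhiProj E y x.1 ∂μ := by
    rw [hmean]
    intro hmin
    refine ⟨fun T hT hET _ w hw => ?_, hii.2 (proj_meanLog_eq_zero h hmin)⟩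
    obtain ⟨a, f, ha, hf, -, he⟩ := hPsiI T hT hET w hw
    rw [he]
    exact ha.inner_nonpos h hf hmin
  refine ⟨fun T hT hET _ w hw => ?_, ?_, ⟨hnec, fun hc => ?_⟩, fun hm z hz hne => ?_⟩
  · obtain ⟨a, f, -, -, hI, -⟩ := hPsiI T hT hET w hw
    exact hI
  · simp_rw [hPhi]
    exact (projCLM E).integrable_comp (hlogI.add (integrable_const x.1))
  · refine hmean.2 fun z => ?_
    by_cases hz : z = x
    · rw [hz]
    · exact (hsuff hc z hz).le
  · have hlt := hsuff (hnec hm) ⟨z, hz⟩ fun he => hne (congrArg IPoint.val he)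
    have hn := energy_nonneg μ x
    rw [hF, hF ⟨z, hz⟩, ENNReal.ofReal_lt_ofReal_iff (by linarith)]
    linarith
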